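/- Let $G$ be a finite connected graph, possibly with multiple edges and self-loops, with vertex set $V(G)$ and minimal degree $\delta(G)\ge 3$; let $\Delta(G)$ be its maximal degree. Let $D(G)$ be the set of oriented edges (every unoriented edge, also a loop, gives two), and let $o(e)$, $t(e)$, $e^{-1}$ be the origin, the terminus and the inverse of $e\in D(G)$; $\deg x$ is the number of $e\in D(G)$ with $o(e)=x$. The Grover matrix $\mathbf U=(U_{e,f})_{e,f\in D(G)}$ is given by $U_{e,f}=2/\deg o(e)$ if $t(f)=o(e)$ and $f\ne e^{-1}$, $U_{e,f}=2/\deg o(e)-1$ if $f=e^{-1}$, and $U_{e,f}=0$ otherwise. The positive support $\mathbf F^+$ of a real matrix $\mathbf F$ has entry $1$ where $\mathbf F$ has a positive entry and $0$ elsewhere. A 2-step-cycle of length $\ell\ge 1$ is a sequence $(e_0,\dots,e_{\ell-1})$ in $D(G)$ such that, for every $i\in\mathbb Z/\ell\mathbb Z$, either $e_i=e_{i+1}$ or there is $g\in D(G)$ with $g\ne e_i^{-1}$, $g\neq e_{i+1}^{-1}$, $o(g)=t(e_i)$, $t(g)=o(e_{i+1})$. It is prime if it does not arise by going $r\ge2$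 times around a 2-step-cycle; two 2-step-cycles are equivalent if they differ by a cyclic permutation. Let $\tilde N_r$ be the number of 2-step-cycles of length $r$, let $\rho$ be the radius of convergence of the power series $\sum_{r\ge1}\frac{\tilde N_r}{r}u^r$, and let $$\tilde{\mathbf Z}_G(u)=\prod_{[\tilde C]}(1-u^{|\tilde C|})^{-1},$$ where $[\tilde C]$ runs over the equivalence classes of prime 2-step-cycles and $|\tilde C|$ is the length of $\tilde C$. Then: 1. $0<\rho<\infty$ and $\dfrac1{(\Delta(G)-1)^2+1}\le\rho$. 2. If $G$ is simple (no multiple edges and no self-loops), then $\rho=1/\alpha$, where $\alpha$ is the maximal eigenvalue of $(\mathbf U^2)^+$ (a real eigenvalue that is at least the modulus of every complex eigenvalue), and $\rho\le\dfrac1{(\delta(G)-1)^2+1}$. 3. The product $\tilde{\mathbf Z}_G(u)$ converges for $|u|<\rho$ and is there equal to a rational function of $u$. This rational function has a pole at $u=\rho$, of order $2$ if $G$ is bipartite and of order $1$ otherwise. -/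

import Mathlib

/-- A graph in which multiple edges and self-loops are allowed, given by its vertices `V` and its
oriented edges `D`. Every unoriented edge (also a loop) contributes two distinct oriented edges,
exchanged by the fixed-point free involution `rev`; `o e` is the origin of `e`. -/
structure OrientedGraph (V D : Type*) where
  /-- the origin of an oriented edge -/
  o : D → V
  /-- the inverse of an oriented edge -/
  rev : D → D
  rev_rev : ∀ e, rev (rev e) = e
  rev_ne : ∀ e, rev e ≠ e

namespace OrientedGraph

variable {V D : Type*} (G : OrientedGraph V D)

/-- The terminus of an oriented edge. -/
def t (e : D) : V := G.o (G.rev e)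

/-- The graph is nonempty and any two vertices are joined by a path. -/
def Connected : Prop :=
  Nonempty V ∧ ∀ x y : V, Relation.ReflTransGen (fun a b => ∃ e, G.o e = a ∧ G.t e = b) x y

/-- The vertices can be split into two classes such that every edge joins the two classes. -/
def Bipartite : Prop := ∃ c : V → Bool, ∀ e, c (G.o e) ≠ c (G.t e)

/-- No self-loops and no multiple edges. -/
def Simple : Prop :=
  (∀ e, G.o e ≠ G.t e) ∧ ∀ e f, G.o e = G.o f → G.t e = G.t f → e = f

/-- The number of oriented edges with origin `x`. -/
def deg [DecidableEq V] [Fintype D] (x : V) : ℕ := (Finset.univ.filter fun e => G.o e = x).card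

/-- The minimal degree `δ(G)`; it is `0` if there is no vertex. -/
noncomputable def minDeg [DecidableEq V] [Fintype D] : ℕ := ⨅ x : V, G.deg x

/-- The maximal degree `Δ(G)` (meant for finitely many vertices). -/
noncomputable def maxDeg [DecidableEq V] [Fintype D] : ℕ := ⨆ x : V, G.deg x

/-- The Grover matrix. -/
noncomputable def grover [DecidableEq V] [Fintype D] [DecidableEq D] : Matrix D D ℝ :=
  Matrix.of fun e f =>
    if f = G.rev e then 2 / (G.deg (G.o e) : ℝ) - 1
    else if G.t f = G.o e then 2 / (G.deg (G.o e) : ℝ)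
    else 0

/-- `(e, f)` is a 2-step-arc. -/
def TwoStepArc (e f : D) : Prop :=
  ∃ g, g ≠ G.rev e ∧ g ≠ G.rev f ∧ G.o g = G.t e ∧ G.t g = G.o f

/-- `(e, f)` is a 2-step-arc or a 2-step-identity. -/
def TwoStep (e f : D) : Prop := G.TwoStepArc e f ∨ e = f

/-- The sequence `l = (e₀, …, e_{ℓ-1})`, `ℓ ≥ 1`, is a 2-step-cycle: every `(e_i, e_{i+1})`, with
indices modulo `ℓ`, is a 2-step-arc or a 2-step-identity. -/
def IsTwoStepCycle (l : List D) : Prop :=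
  l ≠ [] ∧ ∀ (i : ℕ) (hi : i < l.length),
    G.TwoStep l[i] (l[(i + 1) % l.length]'(Nat.mod_lt _ (Nat.zero_lt_of_lt hi)))

/-- `l` is a prime 2-step-cycle: it does not arise by going `r ≥ 2` times around a
2-step-cycle `b`. -/
def IsPrimeTwoStepCycle (l : List D) : Prop :=
  G.IsTwoStepCycle l ∧
    ¬ ∃ (b : List D) (r : ℕ), G.IsTwoStepCycle b ∧ 2 ≤ r ∧ l = (List.replicate r b).flatten

/-- The number of 2-step-cycles (sequences, not classes) of length `r`. -/
noncomputable def numTwoStepCycles (r : ℕ) : ℕ :=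
  Nat.card {l : List D // G.IsTwoStepCycle l ∧ l.length = r}

/-- The equivalence classes, under cyclic permutation, of prime 2-step-cycles
(`Cycle D` is the type of lists up to rotation). -/
def PrimeClass : Type _ :=
  {C : Cycle D // ∃ l : List D, G.IsPrimeTwoStepCycle l ∧ (l : Cycle D) = C}

/-- The factor `(1 - u ^ |C|)⁻¹` of the Euler product of the modified zeta function. -/
noncomputable def eulerFactor (u : ℂ) (C : G.PrimeClass) : ℂ := (1 - u ^ C.1.length)⁻¹

/-- The modified zeta function, given by its Euler product; it is meaningful where the product
converges. -/
noncomputable def modifiedZeta (u : ℂ) : ℂ := ∏' C : G.PrimeClass, G.eulerFactor u C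

/-- The power series `∑_{r ≥ 1} (N_r / r) u ^ r`, where `N_r` is the number of 2-step-cycles of
length `r`. -/
noncomputable def zetaSeries : FormalMultilinearSeries ℂ ℂ ℂ :=
  FormalMultilinearSeries.ofScalars ℂ
    (fun r : ℕ => if r = 0 then (0 : ℂ) else (G.numTwoStepCycles r : ℂ) / (r : ℂ))

end OrientedGraph

/-- The positive support of a real matrix. -/
noncomputable def positiveSupport {ι : Type*} (F : Matrix ι ι ℝ) : Matrix ι ι ℝ :=
  Matrix.of fun i j => if 0 < F i j then 1 else 0

/-- `α` is the maximal eigenvalue of the real matrix `M`: a real eigenvalue that bounds the modulus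
of every complex eigenvalue (in particular it is the largest real eigenvalue). -/
def IsMaximalEigenvalue {ι : Type*} [Fintype ι] [DecidableEq ι] (M : Matrix ι ι ℝ) (α : ℝ) : Prop :=
  Module.End.HasEigenvalue (Matrix.toLin' M) α ∧
    ∀ μ : ℂ, Module.End.HasEigenvalue (Matrix.toLin' (M.map (fun x : ℝ => (x : ℂ)))) μ → ‖μ‖ ≤ α

/-!
Let `T` be the 0-1 matrix of the relation `TwoStep`. The number of 2-step-cycles of length `r` is
`tr (T ^ r)`, the sum of the `r`-th powers of the eigenvalues of `T`. Every 2-step-cycle is in a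
unique way a power of a prime one, and a prime one of length `d` has `d` different rotations
(`bijective_cycleOfPrimeClass`); summing `u ^ |l| / |l|` over all 2-step-cycles `l` in two ways shows
that the Euler product is `1 / det (1 - u T)` (`hasProd_eulerFactor`,
`Matrix.exists_hasSum_trace_pow`). So `ρ = 1 / α` for the spectral radius `α` of `T`, and the order
of the pole at `ρ` is the algebraic multiplicity of `α`.

This multiplicity comes from Perron–Frobenius theory, once it is known which edges reach each other
along 2-step-arcs. The non-backtracking walk with uniform transition probabilities is doubly
stochastic, so reachability is symmetric (`Reach.symm`). As all degrees are at least `3`, edges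
with a common origin reach each other, and so do edges with a common terminus; along an edge from
`x` to `y` the class of the edges leaving `x` is that of the edges entering `y`. By connectedness
there are at most two classes; they coincide unless the graph is bipartite, when they are
distinguished by the colour of the origin (`reach_of_not_bipartite`, `reach_of_color_eq`). As `T` has
a positive diagonal, it is primitive in the first case, and `α` is simple. In the second case `T`
is the sum of a primitive block and of the transpose of that block, by inversion of the edges
(`exists_primitive_block`), and `α` has multiplicity `2`.

The bounds for `α` are bounds for the row sums of `T`. In a simple graph an entry of the square of
the Grover matrix is a single product, whose sign shows that the positive support is the transpose of
`T` (`Simple.positiveSupport_grover_sq`).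
-/

/-! ### Perron–Frobenius theory of primitive matrices -/

namespace Matrix

variable {ι : Type*} [Fintype ι] {A : Matrix ι ι ℝ}

/-- A matrix with positive entries maps nonnegative nonzero vectors to positive ones. -/
theorem mulVec_pos_of_pos {B : Matrix ι ι ℝ} (hB : ∀ i j, 0 < B i j) {v : ι → ℝ}
    (hv : 0 ≤ v) (hv0 : v ≠ 0) (i : ι) : 0 < (B *ᵥ v) i := by
  obtain ⟨j, hj⟩ : ∃ j, v j ≠ 0 := by
    by_contra! h
    exact hv0 (funext h)
  refine Finset.sum_pos' (fun j _ => mul_nonneg (hB i j).le (hv j)) ⟨j, Finset.mem_univ _, ?_⟩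
  exact mul_pos (hB i j) (lt_of_le_of_ne (hv j) (Ne.symm hj))

/-- The eigenvalue of a positive left eigenvector bounds the modulus of every eigenvalue. -/
theorem norm_le_of_pos_left_eigenvector (h0 : ∀ i j, 0 ≤ A i j) {α : ℝ} {w : ι → ℝ}
    (hw : ∀ i, 0 < w i) (hAw : w ᵥ* A = α • w) {μ : ℂ} {z : ι → ℂ} (hz : z ≠ 0)
    (hAz : A.map (fun x : ℝ => (x : ℂ)) *ᵥ z = μ • z) : ‖μ‖ ≤ α := by
  have hpos : 0 < ∑ i, w i * ‖z i‖ := by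
    obtain ⟨j, hj⟩ : ∃ j, z j ≠ 0 := by
      by_contra! h
      exact hz (funext h)
    exact Finset.sum_pos' (fun i _ => mul_nonneg (hw i).le (norm_nonneg _))
      ⟨j, Finset.mem_univ _, mul_pos (hw j) (norm_pos_iff.2 hj)⟩
  have hle : ∀ i, ‖μ‖ * ‖z i‖ ≤ ∑ j, A i j * ‖z j‖ := by
    intro i
    have : μ * z i = ∑ j, (A i j : ℂ) * z j := by
      have := congrFun hAz i
      simpa [mulVec, dotProduct] using this.symm
    rw [← norm_mul, this]
    refine (norm_sum_le _ _).trans (Finset.sum_le_sum fun j _ => ?_)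
    rw [norm_mul, Complex.norm_real, Real.norm_of_nonneg (h0 i j)]
  refine le_of_mul_le_mul_right ?_ hpos
  calc ‖μ‖ * ∑ i, w i * ‖z i‖ = ∑ i, w i * (‖μ‖ * ‖z i‖) := by
        rw [Finset.mul_sum]; exact Finset.sum_congr rfl fun i _ => by ring
    _ ≤ ∑ i, w i * ∑ j, A i j * ‖z j‖ :=
        Finset.sum_le_sum fun i _ => mul_le_mul_of_nonneg_left (hle i) (hw i).le
    _ = w ⬝ᵥ (A *ᵥ fun j => ‖z j‖) := rfl
    _ = α * ∑ i, w i * ‖z i‖ := by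
        rw [dotProduct_mulVec, hAw, smul_dotProduct, smul_eq_mul]; rfl

/-- The eigenvalue of a left eigenvector is the average of the row sums, weighted by the
eigenvector; so bounds for the row sums are bounds for the eigenvalue. -/
theorem eigenvalue_mul_sum {T : Matrix ι ι ℝ} {α : ℝ} {w : ι → ℝ}
    (hw : vecMul w T = α • w) : α * ∑ e, w e = ∑ e, w e * ∑ f, T e f := by
  have h : ∑ f, vecMul w T f = α * ∑ e, w e := by
    rw [hw, Finset.mul_sum]
    rfl
  rw [← h]
  simp only [vecMul, dotProduct, Finset.mul_sum]
  exact Finset.sum_comm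

theorem le_eigenvalue {T : Matrix ι ι ℝ} {α s : ℝ} {w : ι → ℝ} (h0 : ∀ e, 0 ≤ w e) (hne : w ≠ 0)
    (hw : vecMul w T = α • w) (hs : ∀ e, s ≤ ∑ f, T e f) : s ≤ α := by
  have hpos : 0 < ∑ e, w e := Fintype.sum_pos (lt_of_le_of_ne h0 (Ne.symm hne))
  refine le_of_mul_le_mul_right ?_ hpos
  rw [eigenvalue_mul_sum hw, Finset.mul_sum]
  refine Finset.sum_le_sum fun e _ => ?_
  rw [mul_comm]
  exact mul_le_mul_of_nonneg_left (hs e) (h0 e)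

theorem eigenvalue_le {T : Matrix ι ι ℝ} {α s : ℝ} {w : ι → ℝ} (h0 : ∀ e, 0 ≤ w e) (hne : w ≠ 0)
    (hw : vecMul w T = α • w) (hs : ∀ e, ∑ f, T e f ≤ s) : α ≤ s := by
  have hpos : 0 < ∑ e, w e := Fintype.sum_pos (lt_of_le_of_ne h0 (Ne.symm hne))
  refine le_of_mul_le_mul_right ?_ hpos
  rw [eigenvalue_mul_sum hw, Finset.mul_sum]
  refine Finset.sum_le_sum fun e _ => ?_
  rw [mul_comm s]
  exact mul_le_mul_of_nonneg_left (hs e) (h0 e)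

section

variable [DecidableEq ι]

theorem IsPrimitive.transpose (hA : A.IsPrimitive) : Aᵀ.IsPrimitive := by
  obtain ⟨h0, k, hk, hpos⟩ := hA
  refine ⟨fun i j => h0 j i, k, hk, fun i j => ?_⟩
  rw [← transpose_pow]
  exact hpos j i

theorem pow_mulVec_of_eigenvector {v : ι → ℝ} {α : ℝ} (h : A *ᵥ v = α • v) (k : ℕ) :
    (A ^ k) *ᵥ v = α ^ k • v := by
  induction k with
  | zero => simp
  | succ k ih => rw [pow_succ, ← mulVec_mulVec, h, mulVec_smul, ih, smul_smul, pow_succ']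

/-- The eigenvector is found by maximizing `l` over all `x` in the standard simplex with
`l • x ≤ A *ᵥ x` (Collatz–Wielandt). -/
theorem IsPrimitive.exists_pos_eigenvector [Nonempty ι] (hA : A.IsPrimitive) :
    ∃ (α : ℝ) (v : ι → ℝ), (∀ i, 0 < v i) ∧ A *ᵥ v = α • v := by
  obtain ⟨h0, k, -, hpos⟩ := hA
  set C : ℝ := ∑ i, ∑ j, A i j
  have hC : 0 ≤ C := Finset.sum_nonneg fun i _ => Finset.sum_nonneg fun j _ => h0 i j
  -- `C` bounds the admissible `l`, which makes the set of admissible pairs compact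
  have hbound : ∀ (x : ι → ℝ) (l : ℝ), x ∈ stdSimplex ℝ ι → (∀ i, l * x i ≤ (A *ᵥ x) i) →
      l ≤ C := by
    intro x l hx hl
    calc l = ∑ i, l * x i := by rw [← Finset.mul_sum, hx.2, mul_one]
      _ ≤ ∑ i, (A *ᵥ x) i := Finset.sum_le_sum fun i _ => hl i
      _ ≤ C := by
        refine Finset.sum_le_sum fun i _ => Finset.sum_le_sum fun j _ => ?_
        have : x j ≤ 1 := by
          rw [← hx.2]
          exact Finset.single_le_sum (fun i _ => hx.1 i) (Finset.mem_univ j)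
        exact mul_le_of_le_one_right (h0 i j) this
  let K : Set ((ι → ℝ) × ℝ) :=
    (stdSimplex ℝ ι ×ˢ Set.Icc 0 C) ∩ {p | ∀ i, p.2 * p.1 i ≤ (A *ᵥ p.1) i}
  have hK : IsCompact K := by
    refine ((isCompact_stdSimplex ℝ ι).prod isCompact_Icc).inter_right ?_
    simp only [Set.ofPred_forall]
    refine isClosed_iInter fun i => isClosed_le (by fun_prop) ?_
    simp only [mulVec, dotProduct]
    fun_prop
  have hKne : K.Nonempty := by
    obtain ⟨i⟩ := ‹Nonempty ι›
    refine ⟨(Pi.single i 1, 0), ⟨⟨single_mem_stdSimplex ℝ i, le_rfl, hC⟩, fun j => ?_⟩⟩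
    rw [zero_mul]
    refine Finset.sum_nonneg fun l _ => mul_nonneg (h0 j l) ?_
    exact (single_mem_stdSimplex ℝ i).1 l
  obtain ⟨⟨x, l⟩, ⟨⟨hx, hl⟩, hxl⟩, hmax⟩ := hK.exists_isMaxOn hKne continuous_snd.continuousOn
  simp only [Set.mem_ofPred_eq] at hx hl hxl
  have hx0 : x ≠ 0 := by
    rintro rfl
    simpa using hx.2
  have heig : A *ᵥ x = l • x := by
    by_contra hne
    set y : ι → ℝ := (A ^ k) *ᵥ x
    have hy : ∀ i, 0 < y i := mulVec_pos_of_pos hpos hx.1 hx0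
    have hgap : ∀ i, 0 < ((A ^ k) *ᵥ (A *ᵥ x - l • x)) i :=
      mulVec_pos_of_pos hpos (fun i => by simpa using hxl i) (sub_ne_zero.2 hne)
    have hgap' : ∀ i, l * y i < (A *ᵥ y) i := by
      intro i
      have := hgap i
      rw [mulVec_sub, mulVec_smul, mulVec_mulVec, (Commute.pow_self A k).eq,
        ← mulVec_mulVec] at this
      simpa only [Pi.sub_apply, Pi.smul_apply, smul_eq_mul, sub_pos] using this
    obtain ⟨i₀, -, hi₀⟩ := Finset.exists_min_image Finset.univ (fun i => (A *ᵥ y) i / y i)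
      Finset.univ_nonempty
    set l' : ℝ := (A *ᵥ y) i₀ / y i₀
    have hll' : l < l' := (lt_div_iff₀ (hy i₀)).2 (hgap' i₀)
    have hs : 0 < ∑ i, y i := Finset.sum_pos (fun i _ => hy i) Finset.univ_nonempty
    set x' : ι → ℝ := (∑ i, y i)⁻¹ • y
    have hx' : x' ∈ stdSimplex ℝ ι := by
      refine ⟨fun i => mul_nonneg (inv_nonneg.2 hs.le) (hy i).le, ?_⟩
      simp only [x', Pi.smul_apply, smul_eq_mul, ← Finset.mul_sum]
      exact inv_mul_cancel₀ hs.ne'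
    have hxl' : ∀ i, l' * x' i ≤ (A *ᵥ x') i := by
      intro i
      have h1 : l' * y i ≤ (A *ᵥ y) i := (le_div_iff₀ (hy i)).1 (hi₀ i (Finset.mem_univ i))
      simp only [x', mulVec_smul, Pi.smul_apply, smul_eq_mul]
      rw [mul_left_comm]
      exact mul_le_mul_of_nonneg_left h1 (inv_nonneg.2 hs.le)
    have : l' ≤ l := hmax (show (x', l') ∈ K from
      ⟨⟨hx', hl.1.trans hll'.le, hbound x' l' hx' hxl'⟩, hxl'⟩)
    exact absurd hll' (not_lt.2 this)
  refine ⟨l, x, fun i => ?_, heig⟩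
  have h1 := mulVec_pos_of_pos hpos hx.1 hx0 i
  rw [pow_mulVec_of_eigenvector heig] at h1
  exact pos_of_mul_pos_right h1 (pow_nonneg hl.1 k)

/-- Positive left and right eigenvectors belong to the same eigenvalue. -/
theorem IsPrimitive.exists_pos_eigenvectors [Nonempty ι] (hA : A.IsPrimitive) :
    ∃ (α : ℝ) (v w : ι → ℝ), (∀ i, 0 < v i) ∧ (∀ i, 0 < w i) ∧ A *ᵥ v = α • v ∧
      w ᵥ* A = α • w := by
  obtain ⟨α, v, hv, hAv⟩ := hA.exists_pos_eigenvector
  obtain ⟨β, w, hw, hAw⟩ := hA.transpose.exists_pos_eigenvector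
  rw [mulVec_transpose] at hAw
  have hwv : 0 < w ⬝ᵥ v :=
    Finset.sum_pos (fun i _ => mul_pos (hw i) (hv i)) Finset.univ_nonempty
  have h : α * (w ⬝ᵥ v) = β * (w ⬝ᵥ v) := by
    rw [← smul_eq_mul, ← dotProduct_smul, ← hAv, dotProduct_mulVec, hAw, smul_dotProduct,
      smul_eq_mul]
  obtain rfl := mul_right_cancel₀ hwv.ne' h
  exact ⟨α, v, w, hv, hw, hAv, hAw⟩

/-- The eigenvalue of a positive eigenvector of a primitive matrix is geometrically simple. -/
theorem IsPrimitive.mem_span_of_eigenvector [Nonempty ι] (hA : A.IsPrimitive) {α : ℝ}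
    {v z : ι → ℝ} (hv : ∀ i, 0 < v i) (hAv : A *ᵥ v = α • v) (hAz : A *ᵥ z = α • z) :
    ∃ c : ℝ, z = c • v := by
  obtain ⟨h0, k, -, hpos⟩ := hA
  obtain ⟨i₀, -, hi₀⟩ := Finset.exists_min_image Finset.univ (fun i => z i / v i)
    Finset.univ_nonempty
  set c : ℝ := z i₀ / v i₀
  -- `z - c • v` is nonnegative, with a zero at `i₀`
  refine ⟨c, sub_eq_zero.1 ?_⟩
  by_contra hne
  have hnn : 0 ≤ z - c • v := fun i => by
    have := (le_div_iff₀ (hv i)).1 (hi₀ i (Finset.mem_univ i))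
    simpa using this
  have h1 := mulVec_pos_of_pos hpos hnn hne i₀
  have h2 : A *ᵥ (z - c • v) = α • (z - c • v) := by
    rw [mulVec_sub, mulVec_smul, hAv, hAz, smul_sub, smul_comm]
  rw [pow_mulVec_of_eigenvector h2] at h1
  have h3 : (z - c • v) i₀ = 0 := by
    simp [c, div_mul_cancel₀ _ (hv i₀).ne']
  rw [Pi.smul_apply, h3, smul_zero] at h1
  exact lt_irrefl _ h1

/-- The eigenvalue of positive left and right eigenvectors of a primitive matrix is algebraically
simple: a generalized eigenvector of higher order would give `z` with `A *ᵥ z - α • z` a nonzero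
multiple of `v`, which pairing with `w` excludes. -/
theorem IsPrimitive.rootMultiplicity_charpoly [Nonempty ι] (hA : A.IsPrimitive) {α : ℝ}
    {v w : ι → ℝ} (hv : ∀ i, 0 < v i) (hw : ∀ i, 0 < w i) (hAv : A *ᵥ v = α • v)
    (hAw : w ᵥ* A = α • w) : A.charpoly.rootMultiplicity α = 1 := by
  have hwv : 0 < w ⬝ᵥ v :=
    Finset.sum_pos (fun i _ => mul_pos (hw i) (hv i)) Finset.univ_nonempty
  have hv0 : v ≠ 0 := fun h => by
    obtain ⟨i⟩ := ‹Nonempty ι›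
    exact (hv i).ne' (congrFun h i)
  have key : ∀ (k : ℕ) (z : ι → ℝ), ((toLin' A - α • 1) ^ k) z = 0 → ∃ c : ℝ, c • v = z := by
    intro k
    induction k with
    | zero => intro z hz; exact ⟨0, by simpa using hz.symm⟩
    | succ k ih =>
      intro z hz
      rw [pow_succ, Module.End.mul_apply] at hz
      obtain ⟨c, hc⟩ := ih _ hz
      have hc' : c • v = A *ᵥ z - α • z := by simpa using hc
      have h1 : c * (w ⬝ᵥ v) = 0 := by
        rw [← smul_eq_mul, ← dotProduct_smul, hc', dotProduct_sub, dotProduct_mulVec, hAw,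
          smul_dotProduct, dotProduct_smul, sub_self]
      have h2 : c = 0 := (mul_eq_zero.1 h1).resolve_right hwv.ne'
      rw [h2, zero_smul] at hc'
      obtain ⟨d, hd⟩ := hA.mem_span_of_eigenvector hv hAv (sub_eq_zero.1 hc'.symm)
      exact ⟨d, hd.symm⟩
  have hspan : Module.End.maxGenEigenspace (toLin' A) α = Submodule.span ℝ {v} := by
    apply le_antisymm
    · intro z hz
      obtain ⟨k, hk⟩ := Module.End.mem_maxGenEigenspace _ _ _ |>.1 hz
      exact Submodule.mem_span_singleton.2 (key k z hk)
    · rw [Submodule.span_singleton_le_iff_mem]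
      refine (Module.End.mem_maxGenEigenspace _ _ _).2 ⟨1, ?_⟩
      simp [hAv]
  rw [← charpoly_toLin', ← LinearMap.finrank_maxGenEigenspace_eq, hspan,
    finrank_span_singleton hv0]

theorem pow_nonneg_apply (h0 : ∀ i j, 0 ≤ A i j) (r : ℕ) (i j : ι) : 0 ≤ (A ^ r) i j := by
  induction r generalizing i j with
  | zero => by_cases h : i = j <;> simp [h]
  | succ r ih =>
    rw [pow_succ, mul_apply]
    exact Finset.sum_nonneg fun l _ => mul_nonneg (ih i l) (h0 l j)

/-- The traces of the powers of a primitive matrix grow at least like the powers of the Perron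
eigenvalue. -/
theorem IsPrimitive.exists_le_trace_pow [Nonempty ι] (hA : A.IsPrimitive) {α : ℝ}
    {w : ι → ℝ} (hw : ∀ i, 0 < w i) (hAw : w ᵥ* A = α • w) :
    ∃ (c : ℝ) (k : ℕ), 0 < c ∧ ∀ r, c * α ^ r ≤ (A ^ (r + k)).trace := by
  obtain ⟨h0, k, -, hpos⟩ := hA
  obtain ⟨p₀, -, hp₀⟩ := Finset.exists_min_image Finset.univ
    (fun p : ι × ι => (A ^ k) p.1 p.2) Finset.univ_nonempty
  refine ⟨(A ^ k) p₀.1 p₀.2, k, hpos _ _, fun r => ?_⟩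
  have hwA : w ᵥ* (A ^ r) = α ^ r • w := by
    rw [← mulVec_transpose, transpose_pow]
    exact pow_mulVec_of_eigenvector (by rw [mulVec_transpose, hAw]) r
  have hW : 0 < ∑ i, w i := Finset.sum_pos (fun i _ => hw i) Finset.univ_nonempty
  have hsum : α ^ r ≤ ∑ i, ∑ j, (A ^ r) i j := by
    refine le_of_mul_le_mul_left ?_ hW
    calc (∑ i, w i) * α ^ r = ∑ j, (w ᵥ* (A ^ r)) j := by
          rw [hwA, mul_comm]; simp only [Pi.smul_apply, smul_eq_mul, Finset.mul_sum]
      _ = ∑ i, w i * ∑ j, (A ^ r) i j := by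
          simp only [vecMul, dotProduct, Finset.mul_sum]
          rw [Finset.sum_comm]
      _ ≤ ∑ i, (∑ l, w l) * ∑ j, (A ^ r) i j := by
          refine Finset.sum_le_sum fun i _ => mul_le_mul_of_nonneg_right ?_
            (Finset.sum_nonneg fun j _ => pow_nonneg_apply h0 r i j)
          exact Finset.single_le_sum (fun l _ => (hw l).le) (Finset.mem_univ i)
      _ = _ := by rw [← Finset.mul_sum]
  calc (A ^ k) p₀.1 p₀.2 * α ^ r ≤ (A ^ k) p₀.1 p₀.2 * ∑ i, ∑ j, (A ^ r) i j :=
        mul_le_mul_of_nonneg_left hsum (hpos _ _).le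
    _ = ∑ i, ∑ j, (A ^ r) i j * (A ^ k) p₀.1 p₀.2 := by
        rw [mul_comm]; simp only [Finset.sum_mul]
    _ ≤ ∑ i, ∑ j, (A ^ r) i j * (A ^ k) j i := by
        refine Finset.sum_le_sum fun i _ => Finset.sum_le_sum fun j _ => ?_
        exact mul_le_mul_of_nonneg_left (hp₀ (j, i) (Finset.mem_univ _))
          (pow_nonneg_apply h0 r i j)
    _ = (A ^ (r + k)).trace := by simp [pow_add, trace, mul_apply]

/-- A nonnegative matrix with positive diagonal is primitive if any two indices are joined by a
path of positive entries: the support of its powers increases. -/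
theorem isPrimitive_of_reflTransGen (h0 : ∀ i j, 0 ≤ A i j) (hdiag : ∀ i, 0 < A i i)
    (hconn : ∀ i j, Relation.ReflTransGen (fun a b => 0 < A a b) i j) : A.IsPrimitive := by
  have hstep : ∀ (r : ℕ) (i j l : ι), 0 < (A ^ r) i j → 0 < A j l → 0 < (A ^ (r + 1)) i l := by
    intro r i j l h1 h2
    rw [pow_succ, mul_apply]
    exact Finset.sum_pos' (fun m _ => mul_nonneg (pow_nonneg_apply h0 r i m) (h0 m l))
      ⟨j, Finset.mem_univ _, mul_pos h1 h2⟩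
  have hex : ∀ p : ι × ι, ∃ r, 0 < (A ^ r) p.1 p.2 := by
    rintro ⟨i, j⟩
    induction hconn i j with
    | refl => exact ⟨0, by simp⟩
    | tail _ hbc ih => obtain ⟨r, hr⟩ := ih; exact ⟨r + 1, hstep r _ _ _ hr hbc⟩
  choose r hr using hex
  refine ⟨h0, Finset.univ.sup r + 1, Nat.succ_pos _, fun i j => ?_⟩
  have hmono : ∀ m, r (i, j) ≤ m → 0 < (A ^ m) i j := by
    intro m hm
    induction m, hm using Nat.le_induction with
    | base => exact hr (i, j)
    | succ m _ ih => exact hstep m i j j ih (hdiag j)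
  exact hmono _ ((Finset.le_sup (Finset.mem_univ (i, j))).trans (Nat.le_succ _))

end

end Matrix

/-! ### Traces of powers and the reverse characteristic polynomial -/

namespace Matrix

open Polynomial

variable {n : Type*} [Fintype n] [DecidableEq n]

theorem card_roots_charpoly (M : Matrix n n ℂ) :
    M.charpoly.roots.card = Fintype.card n := by
  rw [← (IsAlgClosed.splits M.charpoly).natDegree_eq_card_roots, charpoly_natDegree_eq_dim]

theorem eval_charpoly_eq_prod_roots (M : Matrix n n ℂ) (a : ℂ) :
    M.charpoly.eval a = (M.charpoly.roots.map fun l => a - l).prod := by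
  conv_lhs => rw [(IsAlgClosed.splits M.charpoly).eq_prod_roots_of_monic M.charpoly_monic]
  rw [eval_multiset_prod, Multiset.map_map]
  simp

/-- Both sides are multiplicative in `p`, so it is enough to treat constants and the polynomials
`C a - X`. -/
theorem det_aeval_eq_prod_roots (M : Matrix n n ℂ) (p : ℂ[X]) :
    (aeval M p).det = (M.charpoly.roots.map fun l => p.eval l).prod := by
  have hmul : ∀ p q : ℂ[X], (aeval M p).det = (M.charpoly.roots.map fun l => p.eval l).prod →
      (aeval M q).det = (M.charpoly.roots.map fun l => q.eval l).prod →
      (aeval M (p * q)).det = (M.charpoly.roots.map fun l => (p * q).eval l).prod := by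
    intro p q hp hq
    simp only [map_mul, det_mul, hp, hq, eval_mul, Multiset.prod_map_mul]
  have hC : ∀ c : ℂ, (aeval M (C c)).det = (M.charpoly.roots.map fun l => (C c).eval l).prod := by
    intro c
    simp [Algebra.algebraMap_eq_smul_one, card_roots_charpoly]
  have hX : ∀ a : ℂ,
      (aeval M (X - C a)).det = (M.charpoly.roots.map fun l => (X - C a).eval l).prod := by
    intro a
    have h : (X - C a : ℂ[X]) = C (-1) * (C a - X) := by simp
    rw [h]
    refine hmul _ _ (hC _) ?_
    have := eval_charpoly_eq_prod_roots M a
    rw [eval_charpoly] at this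
    simpa [algebraMap_eq_diagonal, Pi.algebraMap_def] using this
  rw [(IsAlgClosed.splits p).eq_prod_roots]
  refine hmul _ _ (hC _) ?_
  induction p.roots using Multiset.induction_on with
  | empty => simp
  | cons a s ih =>
    rw [Multiset.map_cons, Multiset.prod_cons]
    exact hmul _ _ (hX a) ih

theorem roots_charpoly_aeval (M : Matrix n n ℂ) (p : ℂ[X]) :
    (aeval M p).charpoly.roots = M.charpoly.roots.map fun l => p.eval l := by
  have h : (aeval M p).charpoly =
      ((M.charpoly.roots.map fun l => p.eval l).map fun a => X - C a).prod := by
    refine Polynomial.funext fun x => ?_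
    have := det_aeval_eq_prod_roots M (C x - p)
    rw [eval_charpoly, eval_multiset_prod]
    simpa [algebraMap_eq_diagonal, Pi.algebraMap_def] using this
  rw [h, roots_multiset_prod_X_sub_C]

theorem trace_pow_eq_sum_roots (M : Matrix n n ℂ) (r : ℕ) :
    (M ^ r).trace = (M.charpoly.roots.map fun l => l ^ r).sum := by
  have := roots_charpoly_aeval M (X ^ r)
  simp only [map_pow, aeval_X, eval_pow, eval_X] at this
  rw [trace_eq_sum_roots_charpoly, this]

theorem ofReal_trace_pow (B : Matrix n n ℝ) (r : ℕ) :
    (((B ^ r).trace : ℝ) : ℂ) = ((B.map (fun x : ℝ => (x : ℂ))) ^ r).trace := by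
  have h := map_pow Complex.ofRealHom.mapMatrix B r
  change _ = (Complex.ofRealHom.mapMatrix B ^ r).trace
  rw [← h]
  exact AddMonoidHom.map_trace Complex.ofRealHom (B ^ r)

theorem eval_charpolyRev_eq_prod_roots (M : Matrix n n ℂ) (u : ℂ) :
    M.charpolyRev.eval u = (M.charpoly.roots.map fun l => 1 - u * l).prod := by
  have h := det_aeval_eq_prod_roots M (1 - C u * X)
  simp only [eval_sub, eval_one, eval_mul, eval_C, eval_X] at h
  rw [← h, charpolyRev, ← coe_evalRingHom, RingHom.map_det]
  congr 1
  ext i j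
  rcases eq_or_ne i j with hij | hij <;>
    simp [hij, algebraMap_eq_diagonal, Pi.algebraMap_def, diagonal_mul] <;> ring

/-- The logarithm of `1 / ∏ (1 - u * l)` has the power sums of the `l` as Taylor coefficients. -/
theorem _root_.Multiset.exists_hasSum_powerSum (s : Multiset ℂ) (u : ℂ)
    (hu : ∀ l ∈ s, ‖u * l‖ < 1) :
    ∃ S : ℂ, HasSum (fun r : ℕ => (s.map fun l => l ^ r).sum * u ^ r / r) S ∧
      Complex.exp S = ((s.map fun l => 1 - u * l).prod)⁻¹ := by
  induction s using Multiset.induction_on with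
  | empty => exact ⟨0, by simp [hasSum_zero], by simp⟩
  | cons a s ih =>
    obtain ⟨S, hS, hS'⟩ := ih fun l hl => hu l (Multiset.mem_cons_of_mem hl)
    have ha := hu a (Multiset.mem_cons_self a s)
    have hne : 1 - u * a ≠ 0 := fun h => by
      rw [← sub_eq_zero.1 h, norm_one] at ha
      exact lt_irrefl _ ha
    refine ⟨-Complex.log (1 - u * a) + S, ?_, ?_⟩
    · refine ((Complex.hasSum_taylorSeries_neg_log ha).add hS).congr_fun ?_
      intro r
      simp only [Multiset.map_cons, Multiset.sum_cons]
      ring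
    · rw [Complex.exp_add, hS', Complex.exp_neg, Complex.exp_log hne, Multiset.map_cons,
        Multiset.prod_cons, mul_inv]

theorem exists_hasSum_trace_pow (M : Matrix n n ℂ) (u : ℂ)
    (hu : ∀ l ∈ M.charpoly.roots, ‖u * l‖ < 1) :
    ∃ S : ℂ, HasSum (fun r : ℕ => (M ^ r).trace * u ^ r / r) S ∧
      Complex.exp S = (M.charpolyRev.eval u)⁻¹ := by
  simp only [trace_pow_eq_sum_roots, eval_charpolyRev_eq_prod_roots]
  exact M.charpoly.roots.exists_hasSum_powerSum u hu

/-- The order of the pole of `1 / det (1 - u M)` at `1 / α` is the algebraic multiplicity of the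
eigenvalue `α`. -/
theorem meromorphicOrderAt_inv_charpolyRev (M : Matrix n n ℂ) {α : ℂ} (hα : α ≠ 0) :
    meromorphicOrderAt (fun u => (M.charpolyRev.eval u)⁻¹) α⁻¹ =
      ((-(M.charpoly.rootMultiplicity α : ℤ) : ℤ) : WithTop ℤ) := by
  rw [← count_roots]
  set s := M.charpoly.roots with hs
  set k := s.count α
  set q : ℂ[X] := ((s.filter fun l => ¬ α = l).map fun l => 1 - C l * X).prod with hq
  have heval : ∀ u, M.charpolyRev.eval u = (u - α⁻¹) ^ k * ((-α) ^ k * q.eval u) := by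
    intro u
    rw [eval_charpolyRev_eq_prod_roots, ← hs, ← Multiset.filter_add_not (α = ·) s,
      Multiset.map_add, Multiset.prod_add, Multiset.filter_eq, Multiset.map_replicate,
      Multiset.prod_replicate, hq, eval_multiset_prod, Multiset.map_map, ← mul_assoc, ← mul_pow]
    congr 2
    · field_simp
      ring
    · refine Multiset.map_congr rfl fun l _ => ?_
      simp only [Function.comp_apply, eval_sub, eval_one, eval_mul, eval_C, eval_X, mul_comm]
  have hq0 : q.eval α⁻¹ ≠ 0 := by
    rw [hq, eval_multiset_prod, Multiset.map_map]
    refine Multiset.prod_ne_zero fun h => ?_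
    obtain ⟨l, hl, hl0⟩ := Multiset.mem_map.1 h
    refine (Multiset.mem_filter.1 hl).2 ?_
    simp only [Function.comp_apply, eval_sub, eval_one, eval_mul, eval_C, eval_X] at hl0
    field_simp at hl0
    simpa [sub_eq_zero] using hl0
  have hg : AnalyticAt ℂ (fun u => ((-α) ^ k * q.eval u)) α⁻¹ :=
    analyticAt_const.mul (q.differentiable.analyticAt _)
  have hg0 : (-α) ^ k * q.eval α⁻¹ ≠ 0 := mul_ne_zero (pow_ne_zero _ (neg_ne_zero.2 hα)) hq0
  have hM : MeromorphicAt (fun u => (M.charpolyRev.eval u)⁻¹) α⁻¹ :=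
    ((M.charpolyRev.differentiable.analyticAt _).meromorphicAt).inv
  rw [meromorphicOrderAt_eq_int_iff hM]
  refine ⟨_, hg.inv hg0, inv_ne_zero hg0, Filter.Eventually.of_forall fun u => ?_⟩
  simp only [heval, mul_inv, smul_eq_mul, Pi.inv_apply]
  rw [_root_.zpow_neg, _root_.zpow_natCast]

end Matrix

open Polynomial in
/-- Where `p` does not vanish, the rational function `1 / p` takes the value `1 / p`. -/
theorem RatFunc.eval_inv_algebraMap {p : ℂ[X]} {u : ℂ} (hu : p.eval u ≠ 0) :
    RatFunc.eval (RingHom.id ℂ) u (algebraMap ℂ[X] (RatFunc ℂ) p)⁻¹ = (p.eval u)⁻¹ := by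
  have hp : algebraMap ℂ[X] (RatFunc ℂ) p ≠ 0 := by
    rw [Ne, FaithfulSMul.algebraMap_eq_zero_iff]
    rintro rfl
    simp at hu
  have hden : (algebraMap ℂ[X] (RatFunc ℂ) p)⁻¹.denom.eval u ≠ 0 := by
    intro h
    have hdvd := RatFunc.denom_inv_dvd hp
    rw [RatFunc.num_algebraMap] at hdvd
    exact hu (eval_eq_zero_of_dvd_of_eval_eq_zero hdvd h)
  have h := RatFunc.eval_mul (RingHom.id ℂ) u (x := (algebraMap ℂ[X] (RatFunc ℂ) p)⁻¹)
    (y := algebraMap ℂ[X] (RatFunc ℂ) p) hden (by simp)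
  rw [inv_mul_cancel₀ hp, RatFunc.eval_one, RatFunc.eval_algebraMap] at h
  exact eq_inv_of_mul_eq_one_left h.symm

/-! ### Powers and rotations of words -/

namespace List

variable {β : Type*}

theorem iterate_rotate_one (l : List β) (k : ℕ) :
    (fun l : List β => l.rotate 1)^[k] l = l.rotate k := by
  induction k with
  | zero => simp
  | succ k ih => rw [Function.iterate_succ_apply', ih, rotate_rotate]

theorem isPeriodicPt_rotate_iff {l : List β} {k : ℕ} :
    Function.IsPeriodicPt (fun l : List β => l.rotate 1) k l ↔ l.rotate k = l := by
  rw [Function.IsPeriodicPt, Function.IsFixedPt, iterate_rotate_one]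

theorem length_flatten_replicate (k : ℕ) (b : List β) :
    (replicate k b).flatten.length = k * b.length := by
  simp

theorem flatten_replicate_cons_append (k : ℕ) (a : β) (t : List β) :
    (replicate k (a :: t)).flatten ++ [a] = a :: (replicate k (t ++ [a])).flatten := by
  induction k with
  | zero => simp
  | succ k ih => simp [replicate_succ, append_assoc, ih]

theorem flatten_replicate_rotate_one (k : ℕ) (b : List β) :
    (replicate k b).flatten.rotate 1 = (replicate k (b.rotate 1)).flatten := by
  cases b with
  | nil => simp
  | cons a t =>
    cases k with
    | zero => simp
    | succ k =>
      simp only [replicate_succ, flatten_cons, cons_append, rotate_cons_succ, rotate_zero,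
        append_assoc, flatten_replicate_cons_append]
      simp

theorem flatten_replicate_rotate (k j : ℕ) (b : List β) :
    (replicate k b).flatten.rotate j = (replicate k (b.rotate j)).flatten := by
  induction j with
  | zero => simp
  | succ j ih => rw [← rotate_rotate, ih, flatten_replicate_rotate_one, rotate_rotate]

theorem flatten_replicate_injective {k : ℕ} (hk : k ≠ 0) :
    Function.Injective fun b : List β => (replicate k b).flatten := by
  intro b c h
  have hlen : b.length = c.length := by
    have := congrArg length h
    simp only [length_flatten_replicate] at this
    exact Nat.eq_of_mul_eq_mul_left (Nat.pos_of_ne_zero hk) this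
  obtain ⟨k, rfl⟩ := Nat.exists_eq_succ_of_ne_zero hk
  simp only [replicate_succ, flatten_cons] at h
  exact (append_inj h hlen).1

/-- A power of a word has the same rotational period as the word. -/
theorem minimalPeriod_rotate_flatten_replicate {k : ℕ} (hk : k ≠ 0) (b : List β) :
    Function.minimalPeriod (fun l : List β => l.rotate 1) (replicate k b).flatten =
      Function.minimalPeriod (fun l : List β => l.rotate 1) b := by
  rw [Function.minimalPeriod_eq_minimalPeriod_iff]
  intro j
  rw [isPeriodicPt_rotate_iff, isPeriodicPt_rotate_iff, flatten_replicate_rotate]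
  exact (flatten_replicate_injective hk).eq_iff

/-- If two words commute and the length of `b` divides that of `c`, then `c` is a power of `b`. -/
theorem eq_flatten_replicate_of_append_comm {b c : List β} {q : ℕ}
    (hlen : c.length = q * b.length) (h : b ++ c = c ++ b) : c = (replicate q b).flatten := by
  induction q generalizing c with
  | zero => simpa using hlen
  | succ q ih =>
    have hbc : b <+: c := by
      refine prefix_of_prefix_length_le (prefix_append b c) (h ▸ prefix_append c b) ?_
      rw [hlen]
      exact Nat.le_mul_of_pos_left _ (Nat.succ_pos q)
    obtain ⟨c', rfl⟩ := hbc
    rw [replicate_succ, flatten_cons, ← ih (c := c')]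
    · rw [length_append, Nat.succ_mul] at hlen
      omega
    · simpa [append_assoc] using h

theorem eq_flatten_replicate_of_rotate_eq {l : List β} {d q : ℕ} (hlen : l.length = q * d)
    (h : l.rotate d = l) : l = (replicate q (l.take d)).flatten := by
  cases q with
  | zero => simpa using hlen
  | succ q =>
    have hd : d ≤ l.length := by
      rw [hlen]
      exact Nat.le_mul_of_pos_left _ (Nat.succ_pos q)
    have htake : (l.take d).length = d := by simp [hd]
    have hdrop : (l.drop d).length = q * (l.take d).length := by
      rw [length_drop, htake, hlen, Nat.succ_mul]
      omega
    have hcomm : l.take d ++ l.drop d = l.drop d ++ l.take d := by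
      rw [take_append_drop, ← rotate_eq_drop_append_take hd, h]
    have := eq_flatten_replicate_of_append_comm hdrop hcomm
    rw [replicate_succ, flatten_cons, ← this, take_append_drop]

theorem minimalPeriod_rotate_dvd_length (l : List β) :
    Function.minimalPeriod (fun l : List β => l.rotate 1) l ∣ l.length :=
  (isPeriodicPt_rotate_iff.2 l.rotate_length).minimalPeriod_dvd

/-- Every word is a power of its prefix whose length is the rotational period. -/
theorem eq_flatten_replicate_take_minimalPeriod (l : List β) :
    l = (replicate (l.length / Function.minimalPeriod (fun l : List β => l.rotate 1) l)
      (l.take (Function.minimalPeriod (fun l : List β => l.rotate 1) l))).flatten :=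
  eq_flatten_replicate_of_rotate_eq (Nat.div_mul_cancel l.minimalPeriod_rotate_dvd_length).symm
    (isPeriodicPt_rotate_iff.1 (Function.isPeriodicPt_minimalPeriod _ l))

theorem minimalPeriod_rotate_pos {l : List β} (hl : l ≠ []) :
    0 < Function.minimalPeriod (fun l : List β => l.rotate 1) l :=
  (isPeriodicPt_rotate_iff.2 l.rotate_length).minimalPeriod_pos (length_pos_iff.2 hl)

theorem minimalPeriod_rotate_rotate {l : List β} (hl : l ≠ []) (j : ℕ) :
    Function.minimalPeriod (fun l : List β => l.rotate 1) (l.rotate j) =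
      Function.minimalPeriod (fun l : List β => l.rotate 1) l := by
  rw [← iterate_rotate_one, Function.minimalPeriod_apply_iterate]
  exact Function.minimalPeriod_pos_iff_mem_periodicPts.1 (minimalPeriod_rotate_pos hl)

end List

/-! ### Cycles and prime cycles -/

namespace OrientedGraph

variable {V D : Type*} (G : OrientedGraph V D)

theorem isTwoStepCycle_cons_iff (a : D) (t : List D) :
    G.IsTwoStepCycle (a :: t) ↔ List.IsChain G.TwoStep (a :: (t ++ [a])) := by
  rw [IsTwoStepCycle, List.isChain_iff_getElem]
  simp only [ne_eq, reduceCtorEq, not_false_eq_true, true_and, List.length_cons, List.length_append]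
  have e1 : ∀ (i : ℕ) (hi : i < t.length + 1),
      (a :: (t ++ [a]))[i]'(by simp; omega) = (a :: t)[i]'(by simpa using hi) := by
    rintro (_ | i) hi
    · rfl
    · simp [show i < t.length by omega]
  have e2 : ∀ (i : ℕ) (hi : i < t.length + 1), (a :: (t ++ [a]))[i + 1]'(by simp; omega) =
      (a :: t)[(i + 1) % (t.length + 1)]'(Nat.mod_lt _ (Nat.succ_pos _)) := by
    intro i hi
    rcases Nat.lt_or_ge i t.length with hlt | hge
    · simp [Nat.mod_eq_of_lt (Nat.succ_lt_succ hlt), hlt]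
    · obtain rfl : i = t.length := by omega
      simp
  refine forall_congr' fun i => ⟨fun h hi => ?_, fun h hi => ?_⟩
  · have hi' : i < t.length + 1 := by simpa using hi
    rw [e1 i hi', e2 i hi']
    exact h hi'
  · have := h (by simpa using hi)
    rwa [e1 i hi, e2 i hi] at this

theorem isTwoStepCycle_iff_chain (l : List D) :
    G.IsTwoStepCycle l ↔ l ≠ [] ∧ Cycle.Chain G.TwoStep (l : Cycle D) := by
  cases l with
  | nil => simp [IsTwoStepCycle]
  | cons a t =>
    rw [isTwoStepCycle_cons_iff]
    simp [Cycle.chain_coe_cons]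

theorem isTwoStepCycle_rotate_iff {l : List D} {j : ℕ} :
    G.IsTwoStepCycle (l.rotate j) ↔ G.IsTwoStepCycle l := by
  have h : ((l.rotate j : List D) : Cycle D) = l := Cycle.coe_eq_coe.2 (List.IsRotated.forall l j)
  rw [isTwoStepCycle_iff_chain, isTwoStepCycle_iff_chain, h, Ne, Ne, List.rotate_eq_nil_iff]

theorem isTwoStepCycle_flatten_replicate_iff {b : List D} {k : ℕ} (hk : k ≠ 0) :
    G.IsTwoStepCycle (List.replicate k b).flatten ↔ G.IsTwoStepCycle b := by
  cases b with
  | nil => simp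
  | cons a t =>
    obtain ⟨k, rfl⟩ := Nat.exists_eq_succ_of_ne_zero hk
    have key : ∀ k, List.IsChain G.TwoStep (a :: (List.replicate (k + 1) (t ++ [a])).flatten) ↔
        List.IsChain G.TwoStep (a :: (t ++ [a])) := by
      intro k
      induction k with
      | zero => simp
      | succ k ih =>
        rw [List.replicate_succ, List.flatten_cons, List.append_assoc, ← List.cons_append,
          List.singleton_append, List.isChain_split, ih]
        simp
    rw [isTwoStepCycle_cons_iff, ← key k, ← List.flatten_replicate_cons_append,
      List.replicate_succ, List.flatten_cons, List.cons_append, isTwoStepCycle_cons_iff]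
    simp [List.append_assoc]

/-- Primality means that the rotational period is the length. -/
theorem isPrimeTwoStepCycle_iff {l : List D} :
    G.IsPrimeTwoStepCycle l ↔ G.IsTwoStepCycle l ∧
      Function.minimalPeriod (fun l : List D => l.rotate 1) l = l.length := by
  refine and_congr_right fun hl => ?_
  have hne : l ≠ [] := hl.1
  have hlen : 0 < l.length := List.length_pos_iff.2 hne
  set d := Function.minimalPeriod (fun l : List D => l.rotate 1) l with hd
  have hd0 : 0 < d := List.minimalPeriod_rotate_pos hne
  constructor
  · intro h
    by_contra hlt
    obtain ⟨q, hq⟩ := l.minimalPeriod_rotate_dvd_length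
    rw [← hd] at hq
    have hq2 : 2 ≤ q := by
      rcases q with _ | _ | q
      · omega
      · omega
      · omega
    have hpow := l.eq_flatten_replicate_take_minimalPeriod
    rw [← hd, hq, Nat.mul_div_cancel_left _ hd0] at hpow
    refine h ⟨l.take d, q, ?_, hq2, hpow⟩
    rwa [hpow, G.isTwoStepCycle_flatten_replicate_iff (by omega)] at hl
  · rintro h ⟨b, r, hb, hr, rfl⟩
    have hb0 : 0 < b.length := List.length_pos_iff.2 hb.1
    have h1 : d ≤ b.length := by
      rw [hd, List.minimalPeriod_rotate_flatten_replicate (by omega)]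
      exact Nat.le_of_dvd hb0 b.minimalPeriod_rotate_dvd_length
    rw [h, List.length_flatten_replicate] at h1
    nlinarith

/-- A prime 2-step-cycle representing a given class. -/
noncomputable def PrimeClass.rep {G : OrientedGraph V D} (C : G.PrimeClass) : List D :=
  C.2.choose

theorem PrimeClass.isPrime_rep {G : OrientedGraph V D} (C : G.PrimeClass) :
    G.IsPrimeTwoStepCycle C.rep :=
  C.2.choose_spec.1

theorem PrimeClass.coe_rep {G : OrientedGraph V D} (C : G.PrimeClass) :
    (C.rep : Cycle D) = C.1 :=
  C.2.choose_spec.2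

theorem PrimeClass.length_rep {G : OrientedGraph V D} (C : G.PrimeClass) :
    C.rep.length = C.1.length := by
  rw [← C.coe_rep, Cycle.length_coe]

theorem PrimeClass.length_pos {G : OrientedGraph V D} (C : G.PrimeClass) : 0 < C.1.length := by
  rw [← C.length_rep]
  exact List.length_pos_iff.2 C.isPrime_rep.1.1

/-- The 2-step-cycle that starts at position `j` of the representative of the prime class `C` and
goes `k + 1` times around it. -/
noncomputable def cycleOfPrimeClass
    (p : Σ C : G.PrimeClass, Σ _ : ℕ, Fin C.1.length) : {l : List D // G.IsTwoStepCycle l} :=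
  ⟨(List.replicate (p.2.1 + 1) (p.1.rep.rotate p.2.2)).flatten, by
    rw [isTwoStepCycle_flatten_replicate_iff _ (Nat.succ_ne_zero _), isTwoStepCycle_rotate_iff]
    exact p.1.isPrime_rep.1⟩

theorem length_cycleOfPrimeClass (p : Σ C : G.PrimeClass, Σ _ : ℕ, Fin C.1.length) :
    (G.cycleOfPrimeClass p).1.length = (p.2.1 + 1) * p.1.1.length := by
  rw [cycleOfPrimeClass, List.length_flatten_replicate, List.length_rotate, PrimeClass.length_rep]

/-- Every 2-step-cycle is in a unique way a power of a prime one, and a prime 2-step-cycle has as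
many different rotations as its length. -/
theorem bijective_cycleOfPrimeClass : Function.Bijective G.cycleOfPrimeClass := by
  constructor
  · rintro ⟨C, k, j⟩ ⟨C', k', j'⟩ h
    have h : (List.replicate (k + 1) (C.rep.rotate j)).flatten =
        (List.replicate (k' + 1) (C'.rep.rotate j')).flatten := congrArg Subtype.val h
    have hper : ∀ (C : G.PrimeClass) (k j : ℕ), Function.minimalPeriod
        (fun l : List D => l.rotate 1) (List.replicate (k + 1) (C.rep.rotate j)).flatten =
          C.1.length := by
      intro C k j
      rw [List.minimalPeriod_rotate_flatten_replicate (Nat.succ_ne_zero k),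
        List.minimalPeriod_rotate_rotate C.isPrime_rep.1.1,
        (G.isPrimeTwoStepCycle_iff.1 C.isPrime_rep).2, C.length_rep]
    have hlen : C.1.length = C'.1.length := by
      rw [← hper C k j, ← hper C' k' j', h]
    have hk : k = k' := by
      have := congrArg List.length h
      simp only [List.length_flatten_replicate, List.length_rotate, PrimeClass.length_rep] at this
      rw [hlen] at this
      exact Nat.succ_injective (Nat.eq_of_mul_eq_mul_right C'.length_pos this)
    subst hk
    have hrot := List.flatten_replicate_injective (Nat.succ_ne_zero k) h
    have hC : C = C' := by
      apply Subtype.ext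
      rw [← C.coe_rep, ← C'.coe_rep, Cycle.coe_eq_coe]
      exact (List.IsRotated.forall _ _).symm.trans
        (hrot ▸ List.IsRotated.forall C'.rep j')
    subst hC
    have hj : j = j' := by
      have hp : Function.minimalPeriod (fun l : List D => l.rotate 1) C.rep = C.1.length := by
        rw [(G.isPrimeTwoStepCycle_iff.1 C.isPrime_rep).2, C.length_rep]
      apply Fin.ext
      refine (Function.iterate_eq_iterate_iff_of_lt_minimalPeriod
        (f := fun l : List D => l.rotate 1) (x := C.rep) ?_ ?_).1 ?_
      · rw [hp]; exact j.2
      · rw [hp]; exact j'.2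
      · rw [List.iterate_rotate_one, List.iterate_rotate_one]; exact hrot
    subst hj
    rfl
  · rintro ⟨l, hl⟩
    set d := Function.minimalPeriod (fun l : List D => l.rotate 1) l with hd
    have hd0 : 0 < d := List.minimalPeriod_rotate_pos hl.1
    obtain ⟨q, hq⟩ := l.minimalPeriod_rotate_dvd_length
    rw [← hd] at hq
    have hpow := l.eq_flatten_replicate_take_minimalPeriod
    rw [← hd, hq, Nat.mul_div_cancel_left _ hd0] at hpow
    have hq0 : q ≠ 0 := by
      rintro rfl
      exact hl.1 (List.length_eq_zero_iff.1 hq)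
    have hdl : d ≤ l.length := by
      rw [hq]
      exact Nat.le_mul_of_pos_right _ (Nat.pos_of_ne_zero hq0)
    set b := l.take d
    have hb : G.IsPrimeTwoStepCycle b := by
      rw [isPrimeTwoStepCycle_iff]
      constructor
      · rwa [hpow, G.isTwoStepCycle_flatten_replicate_iff hq0] at hl
      · rw [← List.minimalPeriod_rotate_flatten_replicate hq0, ← hpow, ← hd]
        simp [b, hdl]
    let C : G.PrimeClass := ⟨b, b, hb, rfl⟩
    have hrot : C.rep ~r b := Cycle.coe_eq_coe.1 C.coe_rep
    obtain ⟨j, hj⟩ := hrot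
    refine ⟨⟨C, q - 1, ⟨j % C.1.length, Nat.mod_lt _ C.length_pos⟩⟩, Subtype.ext ?_⟩
    change (List.replicate (q - 1 + 1) (C.rep.rotate (j % C.1.length))).flatten = l
    rw [← C.length_rep, List.rotate_mod, hj, Nat.sub_add_cancel (Nat.pos_of_ne_zero hq0), ← hpow]

end OrientedGraph

/-! ### Counting 2-step-cycles -/

namespace OrientedGraph

variable {V D : Type*} (G : OrientedGraph V D)

open Classical in
/-- The 0-1 matrix of the relation `TwoStep`. -/
noncomputable def twoStepMatrix : Matrix D D ℝ :=
  Matrix.of fun e f => if G.TwoStep e f then 1 else 0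

theorem twoStepMatrix_nonneg (e f : D) : 0 ≤ G.twoStepMatrix e f := by
  simp only [twoStepMatrix, Matrix.of_apply]
  split_ifs <;> norm_num

theorem twoStepMatrix_pos_iff {e f : D} : 0 < G.twoStepMatrix e f ↔ G.TwoStep e f := by
  simp only [twoStepMatrix, Matrix.of_apply]
  split_ifs with h <;> simp [h]

instance finite_list_length_eq [Finite D] (p : List D → Prop) (r : ℕ) :
    Finite {l : List D // p l ∧ l.length = r} :=
  ((List.finite_length_eq D r).subset fun _ hl => hl.2).to_subtype

/-- The entries of the powers of the matrix of `TwoStep` count the paths with given ends. -/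
theorem twoStepMatrix_pow_succ_apply [Fintype D] [DecidableEq D] (r : ℕ) (e f : D) :
    (G.twoStepMatrix ^ (r + 1)) e f =
      Nat.card {l : List D // List.IsChain G.TwoStep (e :: (l ++ [f])) ∧ l.length = r} := by
  classical
  induction r generalizing e with
  | zero =>
    have h : {l : List D | List.IsChain G.TwoStep (e :: (l ++ [f])) ∧ l.length = 0} =
        if G.TwoStep e f then {[]} else ∅ := by
      ext l
      split_ifs with h <;> cases l <;> simp [h]
    rw [zero_add, pow_one, twoStepMatrix, Matrix.of_apply]
    change _ = ((Nat.card ({l : List D | List.IsChain G.TwoStep (e :: (l ++ [f])) ∧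
      l.length = 0} : Set (List D)) : ℕ) : ℝ)
    rw [h]
    split_ifs <;> simp
  | succ r ih =>
    let Φ : (Σ d : D, {l : List D // (G.TwoStep e d ∧ List.IsChain G.TwoStep (d :: (l ++ [f]))) ∧
        l.length = r}) ≃
        {l : List D // List.IsChain G.TwoStep (e :: (l ++ [f])) ∧ l.length = r + 1} :=
      { toFun := fun p => ⟨p.1 :: p.2.1, by
          have := p.2.2
          simpa [List.isChain_cons_cons] using this⟩
        invFun := fun l => match l with
          | ⟨[], h⟩ => absurd h.2 (by simp)
          | ⟨d :: l, h⟩ => ⟨d, l, by simpa [List.isChain_cons_cons] using h⟩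
        left_inv := fun p => rfl
        right_inv := fun l => match l with
          | ⟨[], h⟩ => absurd h.2 (by simp)
          | ⟨d :: l, h⟩ => rfl }
    rw [← Nat.card_congr Φ, Nat.card_sigma, pow_succ', Matrix.mul_apply, Nat.cast_sum]
    refine Finset.sum_congr rfl fun d _ => ?_
    rw [ih, twoStepMatrix, Matrix.of_apply]
    split_ifs with h
    · simp [h]
    · simp [h]

/-- The number of 2-step-cycles of length `r` is the trace of the `r`-th power of the matrix of
`TwoStep`. -/
theorem numTwoStepCycles_eq_trace [Fintype D] [DecidableEq D] {r : ℕ} (hr : r ≠ 0) :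
    (G.numTwoStepCycles r : ℝ) = (G.twoStepMatrix ^ r).trace := by
  obtain ⟨r, rfl⟩ := Nat.exists_eq_succ_of_ne_zero hr
  let Φ : (Σ d : D, {l : List D // List.IsChain G.TwoStep (d :: (l ++ [d])) ∧ l.length = r}) ≃
      {l : List D // G.IsTwoStepCycle l ∧ l.length = r + 1} :=
    { toFun := fun p => ⟨p.1 :: p.2.1, by
        have := p.2.2
        rw [isTwoStepCycle_cons_iff]
        simpa using this⟩
      invFun := fun l => match l with
        | ⟨[], h⟩ => absurd h.2 (by simp)
        | ⟨d :: l, h⟩ => ⟨d, l, by rw [isTwoStepCycle_cons_iff] at h; simpa using h⟩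
      left_inv := fun p => rfl
      right_inv := fun l => match l with
        | ⟨[], h⟩ => absurd h.2 (by simp)
        | ⟨d :: l, h⟩ => rfl }
  rw [numTwoStepCycles, ← Nat.card_congr Φ, Nat.card_sigma, Nat.cast_sum, Matrix.trace]
  exact Finset.sum_congr rfl fun d _ => (G.twoStepMatrix_pow_succ_apply r d d).symm

/-! ### The Euler product -/

/-- The logarithm of the Euler product is the sum of `u ^ |l| / |l|` over all 2-step-cycles `l`:
grouping by length gives the coefficients `N_r / r`, grouping by prime classes gives the logarithms
of the Euler factors. -/
theorem hasProd_eulerFactor [Finite D] {u S : ℂ} (hu : ‖u‖ < 1)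
    (hS : HasSum (fun r : ℕ => (G.numTwoStepCycles r : ℂ) * u ^ r / r) S)
    (habs : Summable fun r : ℕ => (G.numTwoStepCycles r : ℝ) * ‖u‖ ^ r / r) :
    HasProd (G.eulerFactor u) (Complex.exp S) := by
  classical
  let F : {l : List D // G.IsTwoStepCycle l} → ℂ := fun l => u ^ l.1.length / l.1.length
  let fib := fun r : ℕ => {l : {l : List D // G.IsTwoStepCycle l} // l.1.length = r}
  let Φ : (Σ r : ℕ, fib r) ≃ {l : List D // G.IsTwoStepCycle l} :=
    Equiv.sigmaFiberEquiv fun l : {l : List D // G.IsTwoStepCycle l} => l.1.length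
  have hΦ : ∀ (r : ℕ) (x : fib r), F (Φ ⟨r, x⟩) = u ^ r / r := by
    rintro r ⟨l, hl⟩
    change F l = _
    simp only [F, hl]
  let e : ∀ r : ℕ, fib r ≃ {l : List D // G.IsTwoStepCycle l ∧ l.length = r} := fun r =>
    Equiv.subtypeSubtypeEquivSubtypeInter _ fun l : List D => l.length = r
  have hfin : ∀ r, Finite (fib r) := fun r => Finite.of_equiv _ (e r).symm
  have hcard : ∀ r, Nat.card (fib r) = G.numTwoStepCycles r := fun r => Nat.card_congr (e r)
  have hsum : Summable fun p => ‖F (Φ p)‖ := by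
    rw [summable_sigma_of_nonneg fun p => norm_nonneg _]
    refine ⟨fun r => Summable.of_finite, ?_⟩
    refine habs.congr fun r => ?_
    have := Fintype.ofFinite (fib r)
    simp only [hΦ, tsum_const, hcard]
    simp [mul_div_assoc]
  have hF : HasSum F S := by
    rw [← Φ.hasSum_iff]
    have hs : Summable (F ∘ Φ) := hsum.of_norm
    have h2 : HasSum (fun r : ℕ => (G.numTwoStepCycles r : ℂ) * u ^ r / r) (∑' p, (F ∘ Φ) p) := by
      refine hs.hasSum.sigma fun r => ?_
      have := Fintype.ofFinite (fib r)
      have h3 := hasSum_fintype fun x : fib r => F (Φ ⟨r, x⟩)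
      simp only [hΦ, Finset.sum_const, Finset.card_univ, ← Nat.card_eq_fintype_card, hcard,
        nsmul_eq_mul] at h3
      rw [mul_div_assoc]
      simpa only [Function.comp_apply, hΦ] using h3
    rw [hS.unique h2]
    exact hs.hasSum
  let Ψ := Equiv.ofBijective _ G.bijective_cycleOfPrimeClass
  have hG : HasSum (F ∘ Ψ) S := Ψ.hasSum_iff.2 hF
  have hval : ∀ (C : G.PrimeClass) (k : ℕ) (j : Fin C.1.length),
      (F ∘ Ψ) ⟨C, k, j⟩ = u ^ ((k + 1) * C.1.length) / ((k + 1 : ℕ) * C.1.length : ℂ) := by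
    intro C k j
    change F (G.cycleOfPrimeClass ⟨C, k, j⟩) = _
    simp only [F, length_cycleOfPrimeClass, Nat.cast_mul]
  have hlt : ∀ C : G.PrimeClass, ‖u ^ C.1.length‖ < 1 := fun C => by
    rw [norm_pow]
    exact pow_lt_one₀ (norm_nonneg u) hu C.length_pos.ne'
  have hlog : ∀ C : G.PrimeClass, HasSum (fun q : Σ _ : ℕ, Fin C.1.length => (F ∘ Ψ) ⟨C, q⟩)
      (-Complex.log (1 - u ^ C.1.length)) := by
    intro C
    have hs : Summable fun q : Σ _ : ℕ, Fin C.1.length => (F ∘ Ψ) ⟨C, q⟩ :=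
      hG.summable.sigma_factor C
    have h1 : HasSum (fun k : ℕ => (u ^ C.1.length) ^ (k + 1) / ((k + 1 : ℕ) : ℂ))
        (∑' q : Σ _ : ℕ, Fin C.1.length, (F ∘ Ψ) ⟨C, q⟩) := by
      refine hs.hasSum.sigma fun k => ?_
      have h3 := hasSum_fintype fun j : Fin C.1.length => (F ∘ Ψ) ⟨C, k, j⟩
      simp only [hval, Finset.sum_const, Finset.card_univ, Fintype.card_fin, nsmul_eq_mul] at h3
      simp only [hval]
      convert h3 using 1
      have hC : (C.1.length : ℂ) ≠ 0 := Nat.cast_ne_zero.2 C.length_pos.ne'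
      have hk : ((k + 1 : ℕ) : ℂ) ≠ 0 := Nat.cast_ne_zero.2 (Nat.succ_ne_zero k)
      rw [← pow_mul, mul_comm C.1.length (k + 1)]
      field_simp
    have h2 := Complex.hasSum_taylorSeries_neg_log (hlt C)
    rw [← hasSum_nat_add_iff' 1] at h2
    simp only [Finset.range_one, Finset.sum_singleton, Nat.cast_zero, div_zero, sub_zero] at h2
    rw [h2.unique h1]
    exact hs.hasSum
  have hprod := (hG.sigma hlog).cexp
  refine hprod.congr_fun fun C => ?_
  have hne : 1 - u ^ C.1.length ≠ 0 := fun h => by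
    have := hlt C
    rw [← sub_eq_zero.1 h, norm_one] at this
    exact lt_irrefl _ this
  rw [Function.comp_apply, Complex.exp_neg, Complex.exp_log hne, eulerFactor]

end OrientedGraph

/-! ### Reachability by 2-step-arcs -/

/-- If a doubly stochastic matrix has a positive entry at `(i, j)`, then `i` can be reached from `j`
along positive entries: a set that the mass cannot leave cannot receive mass either. -/
theorem reflTransGen_of_doublyStochastic {ι : Type*} [Fintype ι] [DecidableEq ι]
    {P : Matrix ι ι ℝ} (hP : P ∈ doublyStochastic ℝ ι) {i j : ι} (hij : 0 < P i j) :
    Relation.ReflTransGen (fun a b => 0 < P a b) j i := by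
  classical
  by_contra hji
  set s : Finset ι :=
    Finset.univ.filter fun a => Relation.ReflTransGen (fun a b => 0 < P a b) j a with hs
  have hnn := fun a b => nonneg_of_mem_doublyStochastic hP (i := a) (j := b)
  have hrow : ∀ a ∈ s, ∑ b ∈ s, P a b = 1 := by
    intro a ha
    rw [← sum_row_of_mem_doublyStochastic hP a]
    refine Finset.sum_subset (Finset.subset_univ s) fun b _ hb => ?_
    by_contra hne
    have hpos := lt_of_le_of_ne (hnn a b) (Ne.symm hne)
    simp only [hs, Finset.mem_filter_univ] at ha hb
    exact hb (ha.tail hpos)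
  have hi : i ∉ s := by simpa [hs] using hji
  have hj : j ∈ s := by simp [hs, Relation.ReflTransGen.refl]
  have hcol : ∀ b, ∑ a ∈ s, P a b ≤ 1 := fun b => by
    rw [← sum_col_of_mem_doublyStochastic hP b]
    exact Finset.sum_le_sum_of_subset_of_nonneg (Finset.subset_univ s) fun a _ _ => hnn a b
  have hcolj : ∑ a ∈ s, P a j < 1 := by
    rw [← sum_col_of_mem_doublyStochastic hP j]
    exact Finset.sum_lt_sum_of_subset (Finset.subset_univ s) (Finset.mem_univ i) hi hij
      fun a _ _ => hnn a j
  have h1 : ∑ a ∈ s, ∑ b ∈ s, P a b = s.card := by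
    rw [Finset.sum_congr rfl hrow]
    simp
  have h2 : ∑ b ∈ s, ∑ a ∈ s, P a b < s.card := by
    have := Finset.sum_lt_sum (fun b _ => hcol b) ⟨j, hj, hcolj⟩
    simpa using this
  rw [Finset.sum_comm] at h2
  exact absurd h1 h2.ne

namespace OrientedGraph

variable {V D : Type*} (G : OrientedGraph V D)

theorem o_rev (e : D) : G.o (G.rev e) = G.t e := rfl

theorem t_rev (e : D) : G.t (G.rev e) = G.o e := by rw [t, G.rev_rev]

theorem TwoStepArc.rev {G : OrientedGraph V D} {e f : D} (h : G.TwoStepArc e f) :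
    G.TwoStepArc (G.rev f) (G.rev e) := by
  obtain ⟨g, h1, h2, h3, h4⟩ := h
  refine ⟨G.rev g, fun h => h2 ?_, fun h => h1 ?_, ?_, ?_⟩
  · rw [← G.rev_rev g, h, G.rev_rev]
  · rw [← G.rev_rev g, h, G.rev_rev]
  · rw [o_rev, t_rev, h4]
  · rw [t_rev, o_rev, h3]

theorem TwoStep.rev {G : OrientedGraph V D} {e f : D} (h : G.TwoStep e f) :
    G.TwoStep (G.rev f) (G.rev e) :=
  h.imp TwoStepArc.rev fun h => by rw [h]

/-- Reachability along 2-step-arcs. -/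
def Reach (e f : D) : Prop := Relation.ReflTransGen G.TwoStepArc e f

theorem Reach.rev {G : OrientedGraph V D} {e f : D} (h : G.Reach e f) :
    G.Reach (G.rev f) (G.rev e) := by
  induction h with
  | refl => exact Relation.ReflTransGen.refl
  | tail _ hbc ih => exact Relation.ReflTransGen.head hbc.rev ih

theorem TwoStep.color_eq {G : OrientedGraph V D} {c : V → Bool}
    (hc : ∀ e, c (G.o e) ≠ c (G.t e)) {e f : D} (h : G.TwoStep e f) : c (G.o e) = c (G.o f) := by
  rcases h with ⟨g, -, -, h1, h2⟩ | rfl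
  · have a := hc e
    have b := hc g
    rw [h1, h2] at b
    cases h : c (G.o e) <;> cases h' : c (G.t e) <;> cases h'' : c (G.o f) <;> simp_all
  · rfl

theorem Reach.color_eq {G : OrientedGraph V D} {c : V → Bool}
    (hc : ∀ e, c (G.o e) ≠ c (G.t e)) {e f : D} (h : G.Reach e f) : c (G.o e) = c (G.o f) := by
  induction h with
  | refl => rfl
  | tail _ hbc ih => exact ih.trans (TwoStep.color_eq hc (Or.inl hbc))

section

variable [DecidableEq V] [Fintype D]

theorem minDeg_le_deg (x : V) : G.minDeg ≤ G.deg x := ciInf_le (OrderBot.bddBelow _) x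

theorem deg_le_maxDeg [Finite V] (x : V) : G.deg x ≤ G.maxDeg :=
  le_ciSup (Set.finite_range _).bddAbove x

variable {G}

/-- At a vertex of degree at least `3` there is an edge different from two given ones. -/
theorem exists_ne_ne_of_three_le_minDeg [DecidableEq D] (hdeg : 3 ≤ G.minDeg) (x : V) (a b : D) :
    ∃ g, G.o g = x ∧ g ≠ a ∧ g ≠ b := by
  have h3 : 3 ≤ (Finset.univ.filter fun e => G.o e = x).card := hdeg.trans (G.minDeg_le_deg x)
  have h2 : ({a, b} : Finset D).card ≤ 2 := Finset.card_le_two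
  obtain ⟨g, hg, hg'⟩ := Finset.exists_mem_notMem_of_card_lt_card (s := {a, b})
    (t := Finset.univ.filter fun e => G.o e = x) (by omega)
  simp only [Finset.mem_filter_univ] at hg
  simp only [Finset.mem_insert, Finset.mem_singleton, not_or] at hg'
  exact ⟨g, hg, hg'⟩

theorem card_filter_next [DecidableEq D] (e : D) :
    (Finset.univ.filter fun g => G.o g = G.t e ∧ g ≠ G.rev e).card = G.deg (G.t e) - 1 := by
  have h : (Finset.univ.filter fun g => G.o g = G.t e ∧ g ≠ G.rev e) =
      (Finset.univ.filter fun g => G.o g = G.t e).erase (G.rev e) := by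
    ext g
    simp [and_comm]
  rw [h, Finset.card_erase_of_mem (by simp [o_rev]), deg]

theorem card_filter_prev [DecidableEq D] (g : D) :
    (Finset.univ.filter fun e => G.o g = G.t e ∧ g ≠ G.rev e).card = G.deg (G.o g) - 1 := by
  rw [← G.t_rev g, ← card_filter_next (G.rev g)]
  refine Finset.card_bij' (fun e _ => G.rev e) (fun e _ => G.rev e) ?_ ?_ ?_ ?_
  · intro e he
    simp only [Finset.mem_filter_univ, G.rev_rev, G.t_rev, G.o_rev] at he ⊢
    exact ⟨he.1.symm, he.2.symm⟩
  · intro e he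
    simp only [Finset.mem_filter_univ, G.rev_rev, G.t_rev] at he ⊢
    exact ⟨he.1.symm, he.2.symm⟩
  · intro e _; exact G.rev_rev e
  · intro e _; exact G.rev_rev e

variable (G) in
/-- The transition matrix of the non-backtracking random walk on the oriented edges. -/
noncomputable def nonBacktracking [DecidableEq D] : Matrix D D ℝ :=
  Matrix.of fun e g => if G.o g = G.t e ∧ g ≠ G.rev e then ((G.deg (G.t e) - 1 : ℕ) : ℝ)⁻¹ else 0

theorem nonBacktracking_mem_doublyStochastic [DecidableEq D] (hdeg : 3 ≤ G.minDeg) :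
    G.nonBacktracking ∈ doublyStochastic ℝ D := by
  have hd : ∀ x, ((G.deg x - 1 : ℕ) : ℝ) ≠ 0 := fun x => by
    have := hdeg.trans (G.minDeg_le_deg x)
    exact Nat.cast_ne_zero.2 (by omega)
  rw [mem_doublyStochastic_iff_sum]
  refine ⟨fun e g => ?_, fun e => ?_, fun g => ?_⟩
  · simp only [nonBacktracking, Matrix.of_apply]
    split_ifs <;> positivity
  · simp only [nonBacktracking, Matrix.of_apply]
    rw [← Finset.sum_filter, Finset.sum_const, card_filter_next, nsmul_eq_mul,
      mul_inv_cancel₀ (hd _)]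
  · have : ∀ e, G.nonBacktracking e g =
        if G.o g = G.t e ∧ g ≠ G.rev e then ((G.deg (G.o g) - 1 : ℕ) : ℝ)⁻¹ else 0 := by
      intro e
      simp only [nonBacktracking, Matrix.of_apply]
      split_ifs with h
      · rw [h.1]
      · rfl
    simp only [this]
    rw [← Finset.sum_filter, Finset.sum_const, card_filter_prev, nsmul_eq_mul,
      mul_inv_cancel₀ (hd _)]

theorem nonBacktracking_sq_pos_iff [DecidableEq D] (hdeg : 3 ≤ G.minDeg) {e f : D} :
    0 < (G.nonBacktracking ^ 2) e f ↔ G.TwoStepArc e f := by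
  have hnn := (nonBacktracking_mem_doublyStochastic hdeg).1
  have hpos : ∀ e g, 0 < G.nonBacktracking e g ↔ G.o g = G.t e ∧ g ≠ G.rev e := by
    intro e g
    have := hdeg.trans (G.minDeg_le_deg (G.t e))
    have : 0 < ((G.deg (G.t e) - 1 : ℕ) : ℝ) := Nat.cast_pos.2 (by omega)
    simp only [nonBacktracking, Matrix.of_apply]
    split_ifs with h
    · simp [h, this]
    · simp [h]
  rw [sq, Matrix.mul_apply, Finset.sum_pos_iff_of_nonneg fun g _ => mul_nonneg (hnn e g) (hnn g f)]
  have hmul : ∀ g, 0 < G.nonBacktracking e g * G.nonBacktracking g f ↔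
      0 < G.nonBacktracking e g ∧ 0 < G.nonBacktracking g f := by
    intro g
    refine ⟨fun h => ?_, fun h => mul_pos h.1 h.2⟩
    exact ⟨pos_of_mul_pos_left h (hnn g f), pos_of_mul_pos_right h (hnn e g)⟩
  simp only [Finset.mem_univ, true_and, hmul, hpos]
  refine exists_congr fun g => ?_
  have : f ≠ G.rev g ↔ g ≠ G.rev f := by
    refine not_congr ⟨?_, ?_⟩ <;> rintro rfl <;> rw [G.rev_rev]
  rw [this, eq_comm (a := G.o f)]
  tauto

theorem Reach.symm [DecidableEq D] (hdeg : 3 ≤ G.minDeg) {e f : D} (h : G.Reach e f) :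
    G.Reach f e := by
  have hP := pow_mem (nonBacktracking_mem_doublyStochastic hdeg) 2
  induction h with
  | refl => exact Relation.ReflTransGen.refl
  | tail _ hbc ih =>
    have := reflTransGen_of_doublyStochastic hP ((nonBacktracking_sq_pos_iff hdeg).2 hbc)
    simp only [nonBacktracking_sq_pos_iff hdeg] at this
    exact this.trans ih

/-- Two edges with a common terminus have a common successor. -/
theorem reach_of_t_eq [DecidableEq D] (hdeg : 3 ≤ G.minDeg) {e e' : D} (h : G.t e = G.t e') :
    G.Reach e e' := by
  obtain ⟨g, hg, h1, h2⟩ := exists_ne_ne_of_three_le_minDeg hdeg (G.t e) (G.rev e) (G.rev e')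
  obtain ⟨f, hf, h3, -⟩ := exists_ne_ne_of_three_le_minDeg hdeg (G.t g) (G.rev g) (G.rev g)
  have h4 : g ≠ G.rev f := by
    rintro rfl
    exact h3 (G.rev_rev f).symm
  have a : G.TwoStepArc e f := ⟨g, h1, h4, hg, hf.symm⟩
  have b : G.TwoStepArc e' f := ⟨g, h2, h4, hg.trans h, hf.symm⟩
  exact Relation.ReflTransGen.trans (.single a) (Reach.symm hdeg (.single b))

theorem reach_of_o_eq [DecidableEq D] (hdeg : 3 ≤ G.minDeg) {e e' : D} (h : G.o e = G.o e') :
    G.Reach e e' := by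
  have := (reach_of_t_eq hdeg (e := G.rev e') (e' := G.rev e) (by rw [t_rev, t_rev, h])).rev
  rwa [G.rev_rev, G.rev_rev] at this

theorem exists_o_eq [DecidableEq D] (hdeg : 3 ≤ G.minDeg) (x : V) : ∃ e, G.o e = x := by
  by_contra! h
  have h1 : G.deg x = 0 := by simp [deg, h]
  have := hdeg.trans (G.minDeg_le_deg x)
  omega

/-- Relative to a fixed edge `e₀`, the edges starting at a vertex `y` and the edges ending at `y`
are reached from `e₀` and `rev e₀`, in one order or the other. In the second case `y` is joined to
the origin of `e₀` by a path of odd length. -/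
theorem reach_dichotomy [DecidableEq D] (hconn : G.Connected) (hdeg : 3 ≤ G.minDeg) (e₀ : D)
    (y : V) :
    (∀ f, G.o f = y → G.Reach e₀ f ∧ G.Reach (G.rev e₀) (G.rev f)) ∨
      ∀ f, G.o f = y → G.Reach (G.rev e₀) f ∧ G.Reach e₀ (G.rev f) := by
  induction hconn.2 (G.o e₀) y with
  | refl =>
    left
    intro f hf
    exact ⟨reach_of_o_eq hdeg hf.symm, reach_of_t_eq hdeg (by rw [t_rev, t_rev, hf])⟩
  | @tail x z _ hxz ih =>
    obtain ⟨g, rfl, rfl⟩ := hxz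
    -- the edges leaving one end of `g` and those arriving at the other end reach each other
    have h1 : ∀ f, G.o f = G.t g → G.Reach (G.rev g) f := fun f hf =>
      reach_of_o_eq hdeg (by rw [o_rev, hf])
    have h2 : ∀ f, G.o f = G.t g → G.Reach g (G.rev f) := fun f hf =>
      reach_of_t_eq hdeg (by rw [t_rev, hf])
    rcases ih with ih | ih
    · right
      intro f hf
      exact ⟨(ih g rfl).2.trans (h1 f hf), (ih g rfl).1.trans (h2 f hf)⟩
    · left
      intro f hf
      exact ⟨(ih g rfl).2.trans (h1 f hf), (ih g rfl).1.trans (h2 f hf)⟩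

theorem reach_of_not_bipartite [DecidableEq D] (hconn : G.Connected) (hdeg : 3 ≤ G.minDeg)
    (hbip : ¬ G.Bipartite) (e f : D) : G.Reach e f := by
  classical
  obtain ⟨x⟩ := hconn.1
  obtain ⟨e₀, -⟩ := exists_o_eq hdeg x
  -- otherwise the vertices `y` of the first kind in `reach_dichotomy` form one colour class
  have hloop : G.Reach e₀ (G.rev e₀) := by
    by_contra hne
    refine hbip ⟨fun y => decide (∀ f, G.o f = y → G.Reach e₀ f), fun g hg => ?_⟩
    rw [decide_eq_decide] at hg
    rcases reach_dichotomy hconn hdeg e₀ (G.o g) with h | h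
    · have h1 := hg.1 (fun f hf => (h f hf).1) (G.rev g) rfl
      exact hne (h1.trans ((h g rfl).2.symm hdeg))
    · have h1 := hg.2 (fun f hf => (h g rfl).2.trans (reach_of_o_eq hdeg (by rw [o_rev, hf])))
      exact hne ((h1 g rfl).trans ((h g rfl).1.symm hdeg))
  have hall : ∀ f, G.Reach e₀ f := by
    intro f
    rcases reach_dichotomy hconn hdeg e₀ (G.o f) with h | h
    · exact (h f rfl).1
    · exact hloop.trans (h f rfl).1
  exact ((hall e).symm hdeg).trans (hall f)

theorem reach_of_color_eq [DecidableEq D] (hconn : G.Connected) (hdeg : 3 ≤ G.minDeg)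
    {c : V → Bool} (hc : ∀ e, c (G.o e) ≠ c (G.t e)) {e f : D} (hef : c (G.o e) = c (G.o f)) :
    G.Reach e f := by
  rcases reach_dichotomy hconn hdeg e (G.o f) with h | h
  · exact (h f rfl).1
  · exact absurd (hef.trans ((h f rfl).1.color_eq hc).symm) (hc e)

end

/-! ### Row sums and the Grover matrix -/

theorem Simple.eq_rev {G : OrientedGraph V D} (hs : G.Simple) {e g : D}
    (h1 : G.o g = G.t e) (h2 : G.t g = G.o e) : g = G.rev e :=
  hs.2 g (G.rev e) (by rw [o_rev, h1]) (by rw [t_rev, h2])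

section

variable [DecidableEq V] [Fintype D] [DecidableEq D]

/-- The edges that may follow `e` in a non-backtracking walk. -/
def next (e : D) : Finset D := Finset.univ.filter fun g => G.o g = G.t e ∧ g ≠ G.rev e

theorem mem_next {e g : D} : g ∈ G.next e ↔ G.o g = G.t e ∧ g ≠ G.rev e := by simp [next]

theorem card_next (e : D) : (G.next e).card = G.deg (G.t e) - 1 := card_filter_next e

theorem twoStepArc_iff {e f : D} : G.TwoStepArc e f ↔ f ∈ (G.next e).biUnion G.next := by
  simp only [Finset.mem_biUnion, mem_next, TwoStepArc]
  refine exists_congr fun g => ?_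
  have : f ≠ G.rev g ↔ g ≠ G.rev f := by
    refine not_congr ⟨?_, ?_⟩ <;> rintro rfl <;> rw [G.rev_rev]
  rw [this, eq_comm (a := G.o f)]
  tauto

theorem sum_twoStepMatrix (e : D) :
    ∑ f, G.twoStepMatrix e f = (insert e ((G.next e).biUnion G.next)).card := by
  classical
  simp only [twoStepMatrix, Matrix.of_apply, Finset.sum_boole]
  congr 2
  ext f
  simp [TwoStep, twoStepArc_iff, eq_comm, or_comm]

theorem sum_twoStepMatrix_le [Finite V] (hdeg : 3 ≤ G.minDeg) (e : D) :
    ∑ f, G.twoStepMatrix e f ≤ ((G.maxDeg : ℝ) - 1) ^ 2 + 1 := by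
  have h1 : 1 ≤ G.maxDeg := by
    have := (hdeg.trans (G.minDeg_le_deg (G.o e))).trans (G.deg_le_maxDeg (G.o e))
    omega
  have h2 : ∀ e, (G.next e).card ≤ G.maxDeg - 1 := fun e => by
    rw [card_next]
    exact Nat.sub_le_sub_right (G.deg_le_maxDeg _) 1
  have h3 : (insert e ((G.next e).biUnion G.next)).card ≤ (G.maxDeg - 1) * (G.maxDeg - 1) + 1 := by
    refine (Finset.card_insert_le _ _).trans (Nat.succ_le_succ ?_)
    refine (Finset.card_biUnion_le_card_mul _ _ _ fun g _ => h2 g).trans ?_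
    exact Nat.mul_le_mul_right _ (h2 e)
  rw [sum_twoStepMatrix]
  have h4 : ((insert e ((G.next e).biUnion G.next)).card : ℝ) ≤
      (((G.maxDeg - 1) * (G.maxDeg - 1) + 1 : ℕ) : ℝ) := Nat.cast_le.2 h3
  rw [Nat.cast_add, Nat.cast_mul, Nat.cast_sub h1] at h4
  simpa [sq] using h4

variable {G}

theorem Simple.le_sum_twoStepMatrix (hs : G.Simple) (hdeg : 3 ≤ G.minDeg) (e : D) :
    ((G.minDeg : ℝ) - 1) ^ 2 + 1 ≤ ∑ f, G.twoStepMatrix e f := by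
  have h1 : 1 ≤ G.minDeg := by omega
  have h2 : ∀ e, G.minDeg - 1 ≤ (G.next e).card := fun e => by
    rw [card_next]
    exact Nat.sub_le_sub_right (G.minDeg_le_deg _) 1
  have hnot : e ∉ (G.next e).biUnion G.next := by
    simp only [Finset.mem_biUnion, mem_next, not_exists, not_and]
    rintro g ⟨h3, h4⟩ h5
    exact absurd (hs.eq_rev h3 h5.symm) h4
  have hdisj : ((G.next e : Finset D) : Set D).PairwiseDisjoint G.next := by
    intro g hg g' hg' hne
    rw [Function.onFun, Finset.disjoint_left]
    intro f hf hf'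
    rw [Finset.mem_coe, mem_next] at hg hg'
    rw [mem_next] at hf hf'
    exact hne (hs.2 g g' (hg.1.trans hg'.1.symm) (hf.1.symm.trans hf'.1))
  have h3 : (G.minDeg - 1) * (G.minDeg - 1) + 1 ≤
      (insert e ((G.next e).biUnion G.next)).card := by
    rw [Finset.card_insert_of_notMem hnot, Finset.card_biUnion hdisj]
    refine Nat.succ_le_succ ((Nat.mul_le_mul_right _ (h2 e)).trans ?_)
    rw [← smul_eq_mul]
    exact Finset.card_nsmul_le_sum _ _ _ fun g _ => h2 g
  rw [sum_twoStepMatrix]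
  have h4 : (((G.minDeg - 1) * (G.minDeg - 1) + 1 : ℕ) : ℝ) ≤
      ((insert e ((G.next e).biUnion G.next)).card : ℝ) := Nat.cast_le.2 h3
  rw [Nat.cast_add, Nat.cast_mul, Nat.cast_sub h1] at h4
  simpa [sq] using h4

theorem grover_eq_zero {e g : D} (h : G.t g ≠ G.o e) : G.grover e g = 0 := by
  have h' : g ≠ G.rev e := by
    rintro rfl
    exact h (G.t_rev e)
  simp [grover, h, h']

theorem grover_rev_neg (hdeg : 3 ≤ G.minDeg) (e : D) : G.grover e (G.rev e) < 0 := by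
  have h3 : (3 : ℝ) ≤ G.deg (G.o e) := by exact_mod_cast hdeg.trans (G.minDeg_le_deg _)
  simp only [grover, Matrix.of_apply, if_true]
  rw [sub_neg, div_lt_one (by linarith)]
  linarith

theorem grover_pos (hdeg : 3 ≤ G.minDeg) {e g : D} (h : G.t g = G.o e) (h' : g ≠ G.rev e) :
    0 < G.grover e g := by
  have h3 : (3 : ℝ) ≤ G.deg (G.o e) := by exact_mod_cast hdeg.trans (G.minDeg_le_deg _)
  simp only [grover, Matrix.of_apply, h, h', if_true, if_false]
  exact div_pos two_pos (by linarith)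

/-- In a simple graph an entry of the square of the Grover matrix is a single product; it is
positive if both factors are transmissions or both are reflections. -/
theorem Simple.positiveSupport_grover_sq (hs : G.Simple) (hdeg : 3 ≤ G.minDeg) :
    positiveSupport (G.grover ^ 2) = G.twoStepMatrix.transpose := by
  classical
  ext e f
  have key : 0 < (G.grover ^ 2) e f ↔ G.TwoStep f e := by
    rw [sq, Matrix.mul_apply]
    by_cases hex : ∃ g, G.o g = G.t f ∧ G.t g = G.o e
    · obtain ⟨g, hg1, hg2⟩ := hex
      rw [Finset.sum_eq_single g]
      · have hf : G.t f = G.o g := hg1.symm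
        by_cases h1 : g = G.rev e <;> by_cases h2 : f = G.rev g
        · have hfe : f = e := by rw [h2, h1, G.rev_rev]
          subst h2
          refine iff_of_true (mul_pos_of_neg_of_neg ?_ (grover_rev_neg hdeg g)) (Or.inr hfe)
          rw [h1]
          exact grover_rev_neg hdeg e
        · refine iff_of_false (not_lt.2 (mul_nonpos_of_nonpos_of_nonneg ?_ ?_)) ?_
          · rw [h1]; exact (grover_rev_neg hdeg e).le
          · exact (grover_pos hdeg hf h2).le
          · rintro (⟨g', h3, h4, h5, h6⟩ | rfl)
            · exact h4 ((hs.2 g' g (h5.trans hf) (h6.trans hg2.symm)).trans h1)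
            · exact h2 (by rw [h1, G.rev_rev])
        · subst h2
          refine iff_of_false (not_lt.2 (mul_nonpos_of_nonneg_of_nonpos ?_ ?_)) ?_
          · exact (grover_pos hdeg hg2 h1).le
          · exact (grover_rev_neg hdeg g).le
          · rintro (⟨g', h3, h4, h5, h6⟩ | rfl)
            · exact h3 (by rw [G.rev_rev]; exact hs.2 g' g (h5.trans hf) (h6.trans hg2.symm))
            · exact h1 (G.rev_rev g).symm
        · refine iff_of_true (mul_pos (grover_pos hdeg hg2 h1) (grover_pos hdeg hf h2)) (Or.inl ?_)
          refine ⟨g, ?_, h1, hg1, hg2⟩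
          rintro rfl
          exact h2 (G.rev_rev f).symm
      · intro g' _ hne
        by_cases h1 : G.t g' = G.o e
        · rw [grover_eq_zero (e := g') (g := f), mul_zero]
          intro h2
          exact hne (hs.2 g' g (h2.symm.trans hg1.symm) (h1.trans hg2.symm))
        · rw [grover_eq_zero h1, zero_mul]
      · simp
    · rw [Finset.sum_eq_zero]
      · refine iff_of_false (lt_irrefl _) ?_
        rintro (⟨g', -, -, h5, h6⟩ | rfl)
        · exact hex ⟨g', h5, h6⟩
        · exact hex ⟨G.rev f, G.o_rev f, G.t_rev f⟩
      · intro g _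
        by_cases h1 : G.t g = G.o e
        · rw [grover_eq_zero (e := g) (g := f), mul_zero]
          exact fun h2 => hex ⟨g, h2.symm, h1⟩
        · rw [grover_eq_zero h1, zero_mul]
  simp only [positiveSupport, twoStepMatrix, Matrix.of_apply, Matrix.transpose_apply, key]

end

end OrientedGraph

/-! ### The irreducible blocks of the 2-step matrix -/

open Polynomial in
theorem Matrix.charpoly_eq_mul_toSquareBlockProp {n R : Type*} [Fintype n] [DecidableEq n]
    [CommRing R] (M : Matrix n n R) (p : n → Prop) [DecidablePred p]
    (h : ∀ i, ¬ p i → ∀ j, p j → M i j = 0) :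
    M.charpoly = (M.toSquareBlockProp p).charpoly *
      (M.toSquareBlockProp fun i => ¬ p i).charpoly := by
  have hblock : ∀ (q : n → Prop) [DecidablePred q], M.charmatrix.toSquareBlockProp q =
      (M.toSquareBlockProp q).charmatrix := by
    intro q _
    ext i j
    simp [toSquareBlockProp, charmatrix_apply, diagonal_apply, ← Subtype.ext_iff]
  rw [charpoly, twoBlockTriangular_det _ p, hblock, hblock, charpoly, charpoly]
  intro i hi j hj
  have hij : i ≠ j := by
    rintro rfl
    exact hi hj
  rw [charmatrix_apply_ne _ _ _ hij, h i hi j hj, map_zero, neg_zero]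

namespace OrientedGraph

variable {V D : Type*} [Fintype D] [DecidableEq D] {G : OrientedGraph V D}

theorem isPrimitive_toSquareBlockProp {p : D → Prop} [DecidablePred p]
    (hp : ∀ e f, G.TwoStep e f → p e → p f) (hr : ∀ e f, p e → p f → G.Reach e f) :
    (G.twoStepMatrix.toSquareBlockProp p).IsPrimitive := by
  refine Matrix.isPrimitive_of_reflTransGen (fun i j => G.twoStepMatrix_nonneg _ _)
    (fun i => G.twoStepMatrix_pos_iff.2 (Or.inr rfl)) ?_
  rintro ⟨e, he⟩ ⟨f, hf⟩
  have key : ∀ f, G.Reach e f → ∃ hf : p f, Relation.ReflTransGen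
      (fun a b => 0 < G.twoStepMatrix.toSquareBlockProp p a b) ⟨e, he⟩ ⟨f, hf⟩ := by
    intro f h
    induction h with
    | refl => exact ⟨he, .refl⟩
    | tail _ hbc ih =>
      obtain ⟨hb, ih⟩ := ih
      exact ⟨hp _ _ (Or.inl hbc) hb, ih.tail (G.twoStepMatrix_pos_iff.2 (Or.inl hbc))⟩
  exact (key f (hr e f he hf)).2

variable [DecidableEq V]

/-- For a connected graph the matrix of `TwoStep` has a primitive diagonal block `p`. It is the
whole matrix unless the graph is bipartite; in that case the other block is its transpose, by
inversion of the edges. -/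
theorem exists_primitive_block (hconn : G.Connected) (hdeg : 3 ≤ G.minDeg) :
    ∃ (p : D → Prop) (_ : DecidablePred p), (∃ e, p e) ∧
      (∀ e f, G.TwoStep e f → (p e ↔ p f)) ∧
      (G.twoStepMatrix.toSquareBlockProp p).IsPrimitive ∧
      (G.Bipartite → G.twoStepMatrix.charpoly =
        (G.twoStepMatrix.toSquareBlockProp p).charpoly ^ 2) ∧
      (¬ G.Bipartite → G.twoStepMatrix.charpoly =
        (G.twoStepMatrix.toSquareBlockProp p).charpoly ^ 1) := by
  classical
  obtain ⟨x⟩ := hconn.1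
  obtain ⟨e₀, -⟩ := exists_o_eq hdeg x
  have hzero : ∀ p : D → Prop, (∀ e f, G.TwoStep e f → (p e ↔ p f)) →
      ∀ i, ¬ p i → ∀ j, p j → G.twoStepMatrix i j = 0 := by
    intro p hp i hi j hj
    simp only [twoStepMatrix, Matrix.of_apply, ite_eq_right_iff]
    exact fun h => absurd ((hp i j h).2 hj) hi
  by_cases hbip : G.Bipartite
  · obtain ⟨c, hc⟩ := id hbip
    have hp : ∀ e f, G.TwoStep e f → (c (G.o e) = c (G.o e₀) ↔ c (G.o f) = c (G.o e₀)) :=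
      fun e f h => by rw [h.color_eq hc]
    refine ⟨fun e => c (G.o e) = c (G.o e₀), inferInstance, ⟨e₀, rfl⟩, hp, ?_, fun _ => ?_,
      fun h => absurd hbip h⟩
    · exact isPrimitive_toSquareBlockProp (fun e f h => (hp e f h).1)
        fun e f he hf => reach_of_color_eq hconn hdeg hc (he.trans hf.symm)
    · rw [Matrix.charpoly_eq_mul_toSquareBlockProp _ _ (hzero _ hp), sq]
      congr 1
      have hrev : ∀ e, ¬ c (G.o e) = c (G.o e₀) ↔ c (G.o (G.rev e)) = c (G.o e₀) := by
        intro e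
        have := hc e
        rw [o_rev]
        cases h : c (G.o e) <;> cases h' : c (G.t e) <;> cases h'' : c (G.o e₀) <;> simp_all
      let ε : {e // ¬ c (G.o e) = c (G.o e₀)} ≃ {e // c (G.o e) = c (G.o e₀)} :=
        { toFun := fun e => ⟨G.rev e, (hrev e).1 e.2⟩
          invFun := fun e => ⟨G.rev e, (hrev _).2 (by rw [G.rev_rev]; exact e.2)⟩
          left_inv := fun e => Subtype.ext (G.rev_rev e)
          right_inv := fun e => Subtype.ext (G.rev_rev e) }
      rw [← Matrix.charpoly_reindex ε, ← Matrix.charpoly_transpose]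
      congr 1
      ext e f
      have hiff : G.TwoStep (G.rev f) (G.rev e) ↔ G.TwoStep e f :=
        ⟨fun h => by simpa only [G.rev_rev] using h.rev, TwoStep.rev⟩
      simp [Matrix.toSquareBlockProp, twoStepMatrix, ε, hiff]
  · refine ⟨fun _ => True, inferInstance, ⟨e₀, trivial⟩, fun _ _ _ => Iff.rfl, ?_,
      fun h => absurd h hbip, fun _ => ?_⟩
    · exact isPrimitive_toSquareBlockProp (fun _ _ _ _ => trivial)
        fun e f _ _ => reach_of_not_bipartite hconn hdeg hbip e f
    · have : IsEmpty {e : D // ¬ True} := ⟨fun e => e.2 trivial⟩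
      rw [Matrix.charpoly_eq_mul_toSquareBlockProp _ _ (hzero (fun _ => True) fun _ _ _ => Iff.rfl),
        pow_one]
      convert mul_one _
      simp [Matrix.charpoly]

/-! ### The Perron eigenvalue -/

theorem one_le_sum_twoStepMatrix (e : D) : 1 ≤ ∑ f, G.twoStepMatrix e f := by
  rw [sum_twoStepMatrix]
  exact_mod_cast Finset.card_pos.2 (Finset.insert_nonempty _ _)

/-- The spectral data of the 2-step matrix: a dominant eigenvalue `α` with a nonnegative left
eigenvector, its algebraic multiplicity, and the growth of the traces. -/
theorem exists_perron (hconn : G.Connected) (hdeg : 3 ≤ G.minDeg) :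
    ∃ (α : ℝ) (w : D → ℝ), (∀ e, 0 ≤ w e) ∧ w ≠ 0 ∧
      Matrix.vecMul w G.twoStepMatrix = α • w ∧
      (∀ l ∈ (G.twoStepMatrix.map (fun x : ℝ => (x : ℂ))).charpoly.roots, ‖l‖ ≤ α) ∧
      (∃ (c : ℝ) (m : ℕ), 0 < c ∧ ∀ r, c * α ^ r ≤ (G.twoStepMatrix ^ (r + m)).trace) ∧
      (G.Bipartite →
        (G.twoStepMatrix.map (fun x : ℝ => (x : ℂ))).charpoly.rootMultiplicity (α : ℂ) = 2) ∧
      (¬ G.Bipartite →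
        (G.twoStepMatrix.map (fun x : ℝ => (x : ℂ))).charpoly.rootMultiplicity (α : ℂ) = 1) := by
  obtain ⟨p, hdec, ⟨e₀, he₀⟩, hp, hprim, hb, hnb⟩ := exists_primitive_block hconn hdeg
  set T := G.twoStepMatrix with hT
  set A := T.toSquareBlockProp p with hA
  have : Nonempty {e // p e} := ⟨⟨e₀, he₀⟩⟩
  obtain ⟨α, v, w, hv, hw, hAv, hAw⟩ := hprim.exists_pos_eigenvectors
  have hroot : ∀ l ∈ (A.map (fun x : ℝ => (x : ℂ))).charpoly.roots, ‖l‖ ≤ α := by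
    intro l hl
    rw [Polynomial.mem_roots (Matrix.charpoly_monic _).ne_zero, ← Matrix.charpoly_toLin',
      ← Module.End.hasEigenvalue_iff_isRoot_charpoly] at hl
    obtain ⟨z, hz⟩ := hl.exists_hasEigenvector
    refine Matrix.norm_le_of_pos_left_eigenvector hprim.nonneg hw hAw hz.2 ?_
    simpa using hz.apply_eq_smul
  have hmulA : (A.map (fun x : ℝ => (x : ℂ))).charpoly.rootMultiplicity (α : ℂ) = 1 := by
    rw [← hprim.rootMultiplicity_charpoly hv hw hAv hAw,
      Polynomial.eq_rootMultiplicity_map Complex.ofReal_injective (f := Complex.ofRealHom)]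
    rw [← Matrix.charpoly_map]
    rfl
  obtain ⟨k, hk0, hk, hkb, hknb⟩ : ∃ k : ℕ, k ≠ 0 ∧ T.charpoly = A.charpoly ^ k ∧
      (G.Bipartite → k = 2) ∧ (¬ G.Bipartite → k = 1) := by
    by_cases h : G.Bipartite
    · exact ⟨2, by norm_num, hb h, fun _ => rfl, fun h' => absurd h h'⟩
    · exact ⟨1, by norm_num, hnb h, fun h' => absurd h' h, fun _ => rfl⟩
  have hroots : (T.map (fun x : ℝ => (x : ℂ))).charpoly.roots =
      k • (A.map (fun x : ℝ => (x : ℂ))).charpoly.roots := by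
    have h1 := Matrix.charpoly_map T Complex.ofRealHom
    have h2 := Matrix.charpoly_map A Complex.ofRealHom
    rw [hk, Polynomial.map_pow, ← h2] at h1
    change (T.map Complex.ofRealHom).charpoly.roots = k • (A.map Complex.ofRealHom).charpoly.roots
    rw [h1, Polynomial.roots_pow]
  have hmulT : (T.map (fun x : ℝ => (x : ℂ))).charpoly.rootMultiplicity (α : ℂ) = k := by
    rw [← Polynomial.count_roots, hroots, Multiset.count_nsmul, Polynomial.count_roots, hmulA,
      mul_one]
  have htrace : ∀ r, (T ^ r).trace = k * (A ^ r).trace := by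
    intro r
    apply Complex.ofReal_injective
    rw [Matrix.ofReal_trace_pow, Complex.ofReal_mul, Matrix.ofReal_trace_pow,
      Matrix.trace_pow_eq_sum_roots, Matrix.trace_pow_eq_sum_roots, hroots, Multiset.map_nsmul, Multiset.sum_nsmul, nsmul_eq_mul]
    simp
  refine ⟨α, fun e => if h : p e then w ⟨e, h⟩ else 0, fun e => ?_, fun h => ?_, ?_, ?_, ?_,
    fun h => by rw [hmulT, hkb h], fun h => by rw [hmulT, hknb h]⟩
  · dsimp only
    split_ifs with h
    · exact (hw _).le
    · exact le_rfl
  · have := congrFun h e₀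
    simp only [he₀, dif_pos, Pi.zero_apply] at this
    exact (hw _).ne' this
  · ext f
    rw [Pi.smul_apply, smul_eq_mul, Matrix.vecMul, dotProduct,
      ← Fintype.sum_subtype_add_sum_subtype p]
    have hout : ∑ e : {e // ¬ p e}, (if h : p e then w ⟨e, h⟩ else 0) * T e f = 0 :=
      Finset.sum_eq_zero fun e _ => by rw [dif_neg e.2, zero_mul]
    have hin : ∑ e : {e // p e}, (if h : p e then w ⟨e, h⟩ else 0) * T e f =
        ∑ e : {e // p e}, w e * T e f :=
      Finset.sum_congr rfl fun e _ => by rw [dif_pos e.2]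
    rw [hout, hin, add_zero]
    by_cases hf : p f
    · rw [dif_pos hf]
      exact congrFun hAw ⟨f, hf⟩
    · rw [dif_neg hf, mul_zero]
      refine Finset.sum_eq_zero fun e _ => ?_
      have : ¬ G.TwoStep e f := fun h => hf ((hp _ _ h).1 e.2)
      simp [hT, twoStepMatrix, this]
  · intro l hl
    rw [hroots, Multiset.mem_nsmul_of_ne_zero hk0] at hl
    exact hroot l hl
  · obtain ⟨c, m, hc, h⟩ := hprim.exists_le_trace_pow hw hAw
    refine ⟨c, m, hc, fun r => ?_⟩
    rw [htrace]
    refine (h r).trans (le_mul_of_one_le_left ?_ (by exact_mod_cast Nat.pos_of_ne_zero hk0))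
    exact Finset.sum_nonneg fun i _ => Matrix.pow_nonneg_apply hprim.nonneg _ i i

end OrientedGraph

/-! ### Radius of convergence and pole -/

namespace OrientedGraph

variable {V D : Type*} [Fintype D] [DecidableEq D] {G : OrientedGraph V D}

theorem trace_pow_le {α : ℝ}
    (hroots : ∀ l ∈ (G.twoStepMatrix.map (fun x : ℝ => (x : ℂ))).charpoly.roots, ‖l‖ ≤ α)
    (r : ℕ) : (G.twoStepMatrix ^ r).trace ≤ Fintype.card D * α ^ r := by
  refine (le_abs_self _).trans ?_
  rw [← Real.norm_eq_abs, ← Complex.norm_real, Matrix.ofReal_trace_pow,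
    Matrix.trace_pow_eq_sum_roots, ← Matrix.card_roots_charpoly
      (G.twoStepMatrix.map (fun x : ℝ => (x : ℂ)))]
  have key : ∀ s : Multiset ℂ, (∀ l ∈ s, ‖l‖ ≤ α) →
      ‖(s.map fun l => l ^ r).sum‖ ≤ s.card * α ^ r := by
    intro s
    induction s using Multiset.induction_on with
    | empty => simp
    | cons a s ih =>
      intro h
      have h1 := ih fun l hl => h l (Multiset.mem_cons_of_mem hl)
      have h2 : ‖a ^ r‖ ≤ α ^ r := by
        rw [norm_pow]
        exact pow_le_pow_left₀ (norm_nonneg a) (h a (Multiset.mem_cons_self a s)) r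
      rw [Multiset.map_cons, Multiset.sum_cons, Multiset.card_cons, Nat.cast_succ, add_one_mul,
        add_comm]
      exact (norm_add_le _ _).trans (by linarith)
  exact key _ hroots

theorem norm_zetaSeries (r : ℕ) :
    ‖G.zetaSeries r‖ = if r = 0 then 0 else (G.twoStepMatrix ^ r).trace / r := by
  rw [zetaSeries, FormalMultilinearSeries.ofScalars_norm]
  split_ifs with h
  · simp
  · rw [norm_div, Complex.norm_natCast, Complex.norm_natCast, G.numTwoStepCycles_eq_trace h]

/-- The radius of convergence is the inverse of the dominant eigenvalue: the coefficients lie between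
constant multiples of `α ^ r / r` for large `r`. -/
theorem radius_zetaSeries {α : ℝ} (hα : 1 ≤ α)
    (hroots : ∀ l ∈ (G.twoStepMatrix.map (fun x : ℝ => (x : ℂ))).charpoly.roots, ‖l‖ ≤ α)
    (hlow : ∃ (c : ℝ) (m : ℕ), 0 < c ∧ ∀ r, c * α ^ r ≤ (G.twoStepMatrix ^ (r + m)).trace) :
    G.zetaSeries.radius = ENNReal.ofReal (1 / α) := by
  have hα0 : 0 < α := one_pos.trans_le hα
  have hinv : 0 ≤ 1 / α := (one_div_pos.2 hα0).le
  apply le_antisymm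
  · by_contra hlt
    obtain ⟨s, hs1, hs2⟩ := ENNReal.lt_iff_exists_nnreal_btwn.1 (not_le.1 hlt)
    obtain ⟨C, hC0, hC⟩ := G.zetaSeries.norm_mul_pow_le_of_lt_radius hs2
    obtain ⟨c, m, hc, hcm⟩ := hlow
    have hs : 1 / α < s := by
      rw [ENNReal.ofReal, ENNReal.coe_lt_coe] at hs1
      rw [← Real.coe_toNNReal _ hinv]
      exact NNReal.coe_lt_coe.2 hs1
    have hs0 : (0 : ℝ) < s := lt_of_le_of_lt hinv hs
    have hq : 1 < α * s := by rwa [div_lt_iff₀' hα0] at hs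
    -- `c * s ^ m * (α * s) ^ r ≤ C * (r + m)` fails for large `r`
    have hbound : ∀ r : ℕ, 0 < r → c * s ^ m * (α * s) ^ r ≤ C * (r + m) := by
      intro r hr
      have h1 := hC (r + m)
      have hrm : (0 : ℝ) < r + m := by positivity
      rw [norm_zetaSeries, if_neg (by omega), div_mul_eq_mul_div, Nat.cast_add,
        div_le_iff₀ hrm] at h1
      refine le_trans ?_ h1
      calc c * s ^ m * (α * s) ^ r = c * α ^ r * s ^ (r + m) := by ring
        _ ≤ _ := mul_le_mul_of_nonneg_right (hcm r) (by positivity)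
    have hlim := tendsto_pow_const_div_const_pow_of_one_lt 1 hq
    have hcs : 0 < c * s ^ m := by positivity
    have hev := (hlim.const_mul (C * (1 + m))).eventually
      (gt_mem_nhds (show C * (1 + m) * 0 < c * s ^ m by simpa using hcs))
    obtain ⟨r, hr, hr0⟩ := (hev.and (Filter.eventually_gt_atTop 0)).exists
    have hr1 : (1 : ℝ) ≤ r := by exact_mod_cast hr0
    have hpow : 0 < (α * s) ^ r := by positivity
    rw [pow_one, mul_div_assoc', div_lt_iff₀ hpow] at hr
    have h2 := hbound r hr0
    have h3 : C * (r + m) ≤ C * (1 + m) * r := by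
      rw [mul_assoc]
      refine mul_le_mul_of_nonneg_left ?_ hC0.le
      have : (0 : ℝ) ≤ m := Nat.cast_nonneg m
      nlinarith
    linarith
  · rw [ENNReal.ofReal]
    refine G.zetaSeries.le_radius_of_bound (Fintype.card D) fun r => ?_
    rw [Real.coe_toNNReal _ hinv, norm_zetaSeries]
    split_ifs with h
    · simp
    · have hr : (1 : ℝ) ≤ r := by exact_mod_cast Nat.one_le_iff_ne_zero.2 h
      have hr0 : (0 : ℝ) < r := by linarith
      rw [one_div, inv_pow, ← div_eq_mul_inv, div_div, div_le_iff₀ (by positivity)]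
      calc _ ≤ Fintype.card D * α ^ r := trace_pow_le hroots r
        _ ≤ Fintype.card D * (r * α ^ r) := by
          refine mul_le_mul_of_nonneg_left ?_ (Nat.cast_nonneg _)
          exact le_mul_of_one_le_left (by positivity) hr

/-- Within the radius of convergence the Euler product converges to `1 / det (1 - u T)`. -/
theorem hasProd_eulerFactor_inv_charpolyRev {α : ℝ} (hα : 1 ≤ α)
    (hroots : ∀ l ∈ (G.twoStepMatrix.map (fun x : ℝ => (x : ℂ))).charpoly.roots, ‖l‖ ≤ α)
    {u : ℂ} (hu : ‖u‖ < 1 / α) :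
    HasProd (G.eulerFactor u)
      ((G.twoStepMatrix.map (fun x : ℝ => (x : ℂ))).charpolyRev.eval u)⁻¹ := by
  have hα0 : 0 < α := one_pos.trans_le hα
  have hsmall : ∀ z : ℂ, ‖z‖ < 1 / α →
      ∀ l ∈ (G.twoStepMatrix.map (fun x : ℝ => (x : ℂ))).charpoly.roots, ‖z * l‖ < 1 := by
    intro z hz l hl
    rw [norm_mul]
    rw [lt_div_iff₀ hα0] at hz
    exact (mul_le_mul_of_nonneg_left (hroots l hl) (norm_nonneg z)).trans_lt hz
  have hcoeff : ∀ (z : ℂ) (r : ℕ), (G.numTwoStepCycles r : ℂ) * z ^ r / r =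
      ((G.twoStepMatrix.map (fun x : ℝ => (x : ℂ))) ^ r).trace * z ^ r / r := by
    intro z r
    rcases eq_or_ne r 0 with rfl | hr
    · simp
    · rw [← Matrix.ofReal_trace_pow, ← G.numTwoStepCycles_eq_trace hr, Complex.ofReal_natCast]
  obtain ⟨S, hS, hexp⟩ := Matrix.exists_hasSum_trace_pow _ u (hsmall u hu)
  obtain ⟨S', hS', -⟩ := Matrix.exists_hasSum_trace_pow
    (G.twoStepMatrix.map (fun x : ℝ => (x : ℂ))) (‖u‖ : ℂ) (hsmall _ (by simpa using hu))
  rw [← hexp]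
  refine G.hasProd_eulerFactor (hu.trans_le ((div_le_one hα0).2 hα)) ?_ ?_
  · exact hS.congr_fun fun r => hcoeff u r
  · rw [← Complex.summable_ofReal]
    refine hS'.summable.congr fun r => ?_
    rw [← hcoeff]
    push_cast
    rfl

theorem eval_charpolyRev_ne_zero {α : ℝ} (hα : 1 ≤ α)
    (hroots : ∀ l ∈ (G.twoStepMatrix.map (fun x : ℝ => (x : ℂ))).charpoly.roots, ‖l‖ ≤ α)
    {u : ℂ} (hu : ‖u‖ < 1 / α) :
    (G.twoStepMatrix.map (fun x : ℝ => (x : ℂ))).charpolyRev.eval u ≠ 0 := by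
  rw [Matrix.eval_charpolyRev_eq_prod_roots]
  refine Multiset.prod_ne_zero fun h => ?_
  obtain ⟨l, hl, hl0⟩ := Multiset.mem_map.1 h
  have h1 : ‖u * l‖ = 1 := by rw [← sub_eq_zero.1 hl0, norm_one]
  rw [norm_mul] at h1
  rw [lt_div_iff₀ (one_pos.trans_le hα)] at hu
  have := mul_le_mul_of_nonneg_left (hroots l hl) (norm_nonneg u)
  linarith

theorem isMaximalEigenvalue_transpose {T : Matrix D D ℝ} {α : ℝ} {w : D → ℝ} (hne : w ≠ 0)
    (hw : Matrix.vecMul w T = α • w)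
    (hroots : ∀ l ∈ (T.map (fun x : ℝ => (x : ℂ))).charpoly.roots, ‖l‖ ≤ α) :
    IsMaximalEigenvalue T.transpose α := by
  constructor
  · refine Module.End.hasEigenvalue_of_hasEigenvector (x := w)
      ⟨Module.End.mem_eigenspace_iff.2 ?_, hne⟩
    rw [Matrix.toLin'_apply, Matrix.mulVec_transpose, hw]
  · intro l hl
    refine hroots l ?_
    rw [Module.End.hasEigenvalue_iff_isRoot_charpoly, Matrix.charpoly_toLin',
      Matrix.transpose_map, Matrix.charpoly_transpose] at hl
    exact (Polynomial.mem_roots (Matrix.charpoly_monic _).ne_zero).2 hl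

end OrientedGraph

theorem theorem3p2 {V D : Type*} [Fintype V] [DecidableEq V] [Fintype D] [DecidableEq D]
    (G : OrientedGraph V D) (hconn : G.Connected) (hdeg : 3 ≤ G.minDeg) :
    ∃ ρ : ℝ,
      -- `ρ` is the radius of convergence
      0 < ρ ∧ G.zetaSeries.radius = ENNReal.ofReal ρ ∧
      1 / (((G.maxDeg : ℝ) - 1) ^ 2 + 1) ≤ ρ ∧
      (G.Simple →
        (∃ α : ℝ, IsMaximalEigenvalue (positiveSupport (G.grover ^ 2)) α ∧ ρ = 1 / α) ∧
        ρ ≤ 1 / (((G.minDeg : ℝ) - 1) ^ 2 + 1)) ∧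
      -- the zeta function is rational, with a pole at `ρ`
      ∃ R : RatFunc ℂ,
        (∀ u : ℂ, ‖u‖ < ρ →
          Multipliable (G.eulerFactor u) ∧ G.modifiedZeta u = R.eval (RingHom.id ℂ) u) ∧
        (G.Bipartite →
          meromorphicOrderAt (fun u : ℂ => R.eval (RingHom.id ℂ) u) (ρ : ℂ) = ((-2 : ℤ) : WithTop ℤ)) ∧
        (¬ G.Bipartite →
          meromorphicOrderAt (fun u : ℂ => R.eval (RingHom.id ℂ) u) (ρ : ℂ) = ((-1 : ℤ) : WithTop ℤ)) := by
  obtain ⟨α, w, hw0, hwne, hw, hroots, hlow, hb, hnb⟩ := OrientedGraph.exists_perron hconn hdeg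
  have hα : 1 ≤ α :=
    Matrix.le_eigenvalue hw0 hwne hw OrientedGraph.one_le_sum_twoStepMatrix
  have hα0 : 0 < α := one_pos.trans_le hα
  set M := G.twoStepMatrix.map (fun x : ℝ => (x : ℂ))
  have hM0 : M.charpolyRev ≠ 0 := by
    intro h
    have := M.eval_charpolyRev
    rw [h, Polynomial.eval_zero] at this
    exact zero_ne_one this
  have horder : meromorphicOrderAt (fun u : ℂ => RatFunc.eval (RingHom.id ℂ) u
      (algebraMap (Polynomial ℂ) (RatFunc ℂ) M.charpolyRev)⁻¹) ((1 / α : ℝ) : ℂ) =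
        ((-(M.charpoly.rootMultiplicity (α : ℂ) : ℤ) : ℤ) : WithTop ℤ) := by
    rw [← M.meromorphicOrderAt_inv_charpolyRev (Complex.ofReal_ne_zero.2 hα0.ne')]
    rw [one_div, Complex.ofReal_inv]
    refine meromorphicOrderAt_congr ?_
    -- near the pole the polynomial has no other zero
    have hfin : {u : ℂ | M.charpolyRev.IsRoot u}.Finite := Polynomial.finite_setOfPred_isRoot hM0
    filter_upwards [(hfin.subset Set.sdiff_subset).isClosed.isOpen_compl.mem_nhds
        (show ((α : ℂ)⁻¹) ∈ ({u : ℂ | M.charpolyRev.IsRoot u} \ {(α : ℂ)⁻¹})ᶜ from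
          fun h => h.2 rfl) |> mem_nhdsWithin_of_mem_nhds, self_mem_nhdsWithin] with u hu hu'
    exact RatFunc.eval_inv_algebraMap fun h => hu ⟨h, hu'⟩
  refine ⟨1 / α, one_div_pos.2 hα0, OrientedGraph.radius_zetaSeries hα hroots hlow, ?_, ?_,
    (algebraMap (Polynomial ℂ) (RatFunc ℂ) M.charpolyRev)⁻¹, ?_, ?_, ?_⟩
  · exact one_div_le_one_div_of_le hα0
      (Matrix.eigenvalue_le hw0 hwne hw (G.sum_twoStepMatrix_le hdeg))
  · intro hs
    refine ⟨⟨α, ?_, rfl⟩, ?_⟩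
    · rw [hs.positiveSupport_grover_sq hdeg]
      exact OrientedGraph.isMaximalEigenvalue_transpose hwne hw hroots
    · exact one_div_le_one_div_of_le (by positivity)
        (Matrix.le_eigenvalue hw0 hwne hw (hs.le_sum_twoStepMatrix hdeg))
  · intro u hu
    have h := OrientedGraph.hasProd_eulerFactor_inv_charpolyRev hα hroots hu
    refine ⟨h.multipliable, ?_⟩
    rw [RatFunc.eval_inv_algebraMap (OrientedGraph.eval_charpolyRev_ne_zero hα hroots hu)]
    exact h.tprod_eq
  · intro h
    rw [horder, hb h]
    norm_num
  · intro h
    rw [horder, hnb h]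
    norm_num
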